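/- Let $(M,g)$ be a connected compact Riemannian manifold without boundary, of dimension $n\ge 2$, with Levi-Civita connection $\nabla$. For a smooth symmetric covariant $2$-tensor field $\varphi$ put $(\operatorname{div}\varphi)(Z)=\sum_i(\nabla_{e_i}\varphi)(e_i,Z)$, where $(e_i)$ is an orthonormal basis of the tangent space, and $$(S\varphi)(X,Y,Z)=(\nabla_X\varphi)(Y,Z)-\frac{1}{n+1}\bigl(g(X,Y)\operatorname{div}\varphi(Z)+g(X,Z)\operatorname{div}\varphi(Y)\bigr).$$ For a smooth covariant $3$-tensor field $\Phi$, symmetric in its last two arguments, put $(\operatorname{tr}_g\Phi)(Z)=\sum_i\Phi(e_i,e_i,Z)$ and $$(S^*\Phi)(Y,Z)=-\sum_i(\nabla_{e_i}\Phi)(e_i,Y,Z)+\frac{1}{n+1}\bigl((\nabla_Y\operatorname{tr}_g\Phi)(Z)+(\nabla_Z\operatorname{tr}_g\Phi)(Y)\bigr),$$ the formal $L^2$-adjoint of $S$. Let $\ker(S^*S)$ be the space of smooth symmetric $2$-tensor fields $\varphi$ with $S^*(S\varphi)=0$. Assume that $(M,g)$ has nonpositive sectional curvature. Then every $\varphi\in\ker(S^*S)$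 is parallel, i.e. $\nabla\varphi=0$. If moreover there is a point of $M$ at which all sectional curvatures are negative, then $\ker(S^*S)=\{Cg : C\in\mathbb{R}\}$. -/

import Mathlib

open scoped Manifold ContDiff Bundle

noncomputable section

namespace Sinyukov

variable {n : ℕ} {M : Type*} [TopologicalSpace M] [ChartedSpace (EuclideanSpace ℝ (Fin n)) M]

/-! ### Smooth metrics and smooth symmetric 2-tensor fields -/

/-- A smooth Riemannian metric on the `n`-manifold `M`. -/
abbrev Metric (n : ℕ) (M : Type*) [TopologicalSpace M]
    [ChartedSpace (EuclideanSpace ℝ (Fin n)) M] [IsManifold (𝓡 n) ∞ M] :=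
  Bundle.ContMDiffRiemannianMetric (𝓡 n) ∞ (EuclideanSpace ℝ (Fin n))
    (fun x : M => TangentSpace (𝓡 n) x)

/-- The space `C^∞(S²T*M)` of smooth symmetric covariant 2-tensor fields. -/
structure SymmTwoTensor (n : ℕ) (M : Type*) [TopologicalSpace M]
    [ChartedSpace (EuclideanSpace ℝ (Fin n)) M] [IsManifold (𝓡 n) ∞ M] where
  /-- The bilinear form `φ_x` on `T_x M`. -/
  form (x : M) : TangentSpace (𝓡 n) x →L[ℝ] TangentSpace (𝓡 n) x →L[ℝ] ℝ
  symm (x : M) (v w : TangentSpace (𝓡 n) x) : form x v w = form x w v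
  contMDiff : ContMDiff (𝓡 n)
    ((𝓡 n).prod 𝓘(ℝ, EuclideanSpace ℝ (Fin n) →L[ℝ] EuclideanSpace ℝ (Fin n) →L[ℝ] ℝ)) ∞
    (fun x => Bundle.TotalSpace.mk'
      (EuclideanSpace ℝ (Fin n) →L[ℝ] EuclideanSpace ℝ (Fin n) →L[ℝ] ℝ)
      (E := fun x : M => TangentSpace (𝓡 n) x →L[ℝ] TangentSpace (𝓡 n) x →L[ℝ] ℝ) x (form x))

/-! ### Covariant tensors at a point and their components -/

/-- Covariant `k`-tensors on the tangent space `T_x M`. -/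
abbrev Tensor (n k : ℕ) {M : Type*} [TopologicalSpace M]
    [ChartedSpace (EuclideanSpace ℝ (Fin n)) M] (x : M) :=
  MultilinearMap ℝ (fun _ : Fin k => TangentSpace (𝓡 n) x) ℝ

/-- The `i`-th coordinate vector `∂_i` at `x` of the preferred chart at `x`. In Mathlib `T_x M` is
the model space, a vector being identified with its coordinates in the preferred chart at `x`;
see `coordField_center`. -/
def frame (x : M) (i : Fin n) : TangentSpace (𝓡 n) x :=
  (EuclideanSpace.single i (1 : ℝ) : EuclideanSpace ℝ (Fin n))

/-- The `i`-th coordinate covector `dx^i` at `x` of the preferred chart at `x`. -/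
def coframe (x : M) (i : Fin n) : TangentSpace (𝓡 n) x →ₗ[ℝ] ℝ where
  toFun v := WithLp.ofLp (p := 2) (V := Fin n → ℝ) v i
  map_add' _ _ := rfl
  map_smul' _ _ := rfl

/-- `dx^i(∂_j) = δ_ij`. -/
theorem coframe_frame (x : M) (i j : Fin n) : coframe x i (frame x j) = if i = j then 1 else 0 := by
  change (EuclideanSpace.single j (1 : ℝ) : EuclideanSpace ℝ (Fin n)) i = _
  simp

/-- The coordinate vector field `∂_i` of the preferred chart at `c`, at the point with
coordinates `y`. -/
def coordField (c : M) (y : EuclideanSpace ℝ (Fin n)) (i : Fin n) :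
    TangentSpace (𝓡 n) ((extChartAt (𝓡 n) c).symm y) :=
  mfderiv 𝓘(ℝ, EuclideanSpace ℝ (Fin n)) (𝓡 n) (extChartAt (𝓡 n) c).symm y
    (EuclideanSpace.single i (1 : ℝ) : EuclideanSpace ℝ (Fin n))

/-- The vectors `frame x i` are the coordinate vectors at `x` of the preferred chart at `x`. -/
theorem coordField_center [IsManifold (𝓡 n) 1 M] (x : M) (i : Fin n) :
    (coordField x (extChartAt (𝓡 n) x x) i : EuclideanSpace ℝ (Fin n)) = frame x i := by
  have h := mfderivWithin_range_extChartAt_symm (I := 𝓡 n) (x := x)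
  rw [ModelWithCorners.range_eq_univ, mfderivWithin_univ] at h
  unfold coordField frame
  rw [h]
  rfl

/-- The tensor `∑ A_{i₁…i_k} dx^{i₁} ⊗ ⋯ ⊗ dx^{i_k}` at `x` (in the preferred chart at `x`). -/
def ofComponents {k : ℕ} (x : M) (A : (Fin k → Fin n) → ℝ) : Tensor n k x :=
  ∑ J : Fin k → Fin n,
    A J • (MultilinearMap.mkPiAlgebra ℝ (Fin k) ℝ).compLinearMap (fun s => coframe x (J s))

/-- The component `T_{i₁…i_k}` of a tensor field in the preferred chart at `c`, at the point with
coordinates `y`. -/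
def component {k : ℕ} (c : M) (T : (p : M) → Tensor n k p) (J : Fin k → Fin n)
    (y : EuclideanSpace ℝ (Fin n)) : ℝ :=
  T ((extChartAt (𝓡 n) c).symm y) (fun s => coordField c y (J s))

/-- The partial derivative `∂_i f` on `ℝⁿ`. -/
def partialDeriv (i : Fin n) (f : EuclideanSpace ℝ (Fin n) → ℝ)
    (y : EuclideanSpace ℝ (Fin n)) : ℝ :=
  fderiv ℝ f y (EuclideanSpace.single i (1 : ℝ))

/-- A symmetric 2-tensor field as a field of multilinear maps. -/
def toTensor [IsManifold (𝓡 n) ∞ M] (φ : SymmTwoTensor n M) (x : M) : Tensor n 2 x :=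
  MultilinearMap.mk' (fun v => φ.form x (v 0) (v 1))
    (by intro m i a b; fin_cases i <;> simp)
    (by intro m i c a; fin_cases i <;> simp)

section Riemannian

variable [IsManifold (𝓡 n) ∞ M] (g : Metric n M)

/-! ### The Levi-Civita connection -/

/-- The matrix `(g_ij)` of the metric in the preferred chart at `c`. -/
def metricMatrix (c : M) (y : EuclideanSpace ℝ (Fin n)) : Matrix (Fin n) (Fin n) ℝ :=
  Matrix.of fun i j =>
    g.inner ((extChartAt (𝓡 n) c).symm y) (coordField c y i) (coordField c y j)

/-- The Christoffel symbols
`Γ^k_ij = ½ ∑_l g^{kl} (∂_i g_jl + ∂_j g_il - ∂_l g_ij)` in the preferred chart at `c`. -/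
def christoffel (c : M) (k i j : Fin n) (y : EuclideanSpace ℝ (Fin n)) : ℝ :=
  (1 / 2) * ∑ l, (metricMatrix g c y)⁻¹ k l *
    (partialDeriv i (fun z => metricMatrix g c z j l) y
      + partialDeriv j (fun z => metricMatrix g c z i l) y
      - partialDeriv l (fun z => metricMatrix g c z i j) y)

/-- The covariant derivative `∇T` of a covariant tensor field for the Levi-Civita connection,
with the direction of differentiation in the first slot:
`(∇T)_{a i₁…i_k} = ∂_a T_{i₁…i_k} - ∑_s ∑_l Γ^l_{a i_s} T_{i₁…l…i_k}` (`l` in position `s`). -/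
def covDeriv {k : ℕ} (T : (p : M) → Tensor n k p) (x : M) : Tensor n (k + 1) x :=
  ofComponents x fun J =>
    let y := extChartAt (𝓡 n) x x
    partialDeriv (J 0) (component x T (Fin.tail J)) y
      - ∑ s : Fin k, ∑ l : Fin n,
          christoffel g x l (J 0) (J s.succ) y
            * component x T (Function.update (Fin.tail J) s l) y

/-- The trace `∑ g^{ij} T(∂_i, ∂_j, …)` over the first two slots; it does not depend on the
basis. -/
def metricTrace {k : ℕ} {x : M} (T : Tensor n (k + 2) x) : Tensor n k x :=
  ∑ i : Fin n, ∑ j : Fin n,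
    ((Matrix.of fun a b => g.inner x (frame x a) (frame x b))⁻¹ i j) •
      (T.curryLeft (frame x i)).curryLeft (frame x j)

/-! ### Curvature -/

/-- The components `R^m_{kij}` of the curvature in the preferred chart at `c`:
`R(∂_i, ∂_j) ∂_k = ∑_m R^m_{kij} ∂_m`, where `R(X, Y) = ∇_X ∇_Y - ∇_Y ∇_X - ∇_[X,Y]`. -/
def curvatureComponent (c : M) (m k i j : Fin n) (y : EuclideanSpace ℝ (Fin n)) : ℝ :=
  partialDeriv i (christoffel g c m j k) y - partialDeriv j (christoffel g c m i k) y
    + ∑ p, (christoffel g c m i p y * christoffel g c p j k y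
      - christoffel g c m j p y * christoffel g c p i k y)

/-- The Riemann tensor `(X, Y, Z, W) ↦ g(R(X, Y) Z, W)` at `x`. -/
def riemannTensor (x : M) : Tensor n 4 x :=
  ofComponents x fun J => ∑ m : Fin n,
    curvatureComponent g x m (J 2) (J 0) (J 1) (extChartAt (𝓡 n) x x)
      * g.inner x (frame x m) (frame x (J 3))

/-- The sectional curvature of the plane spanned by the linearly independent vectors `u`, `v`. -/
def sectionalCurvature (x : M) (u v : TangentSpace (𝓡 n) x) : ℝ :=
  riemannTensor g x ![u, v, v, u] / (g.inner x u u * g.inner x v v - g.inner x u v ^ 2)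

/-- `(M, g)` has nonpositive sectional curvature. -/
def NonposCurved : Prop :=
  ∀ (x : M) (u v : TangentSpace (𝓡 n) x), LinearIndependent ℝ ![u, v] →
    sectionalCurvature g x u v ≤ 0

/-- All sectional curvatures at the point `x` are negative. -/
def NegCurvedAt (x : M) : Prop :=
  ∀ u v : TangentSpace (𝓡 n) x, LinearIndependent ℝ ![u, v] →
    sectionalCurvature g x u v < 0

/-! ### The operators `div`, `S`, `S*` and the kernel of `S*S` -/

/-- `φ` is parallel: `∇φ = 0`. -/
def IsParallel (φ : SymmTwoTensor n M) : Prop :=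
  ∀ x : M, covDeriv g (toTensor φ) x = 0

/-- The divergence `(div φ)(W) = trace_g (∇φ)(·, ·, W)`. -/
def divergence (φ : SymmTwoTensor n M) (x : M) : Tensor n 1 x :=
  metricTrace g (covDeriv g (toTensor φ) x)

/-- A covariant 1-tensor at `x` as a linear form on `T_x M`. -/
def toForm {x : M} (θ : Tensor n 1 x) : TangentSpace (𝓡 n) x →ₗ[ℝ] ℝ :=
  (MultilinearMap.ofSubsingleton ℝ (TangentSpace (𝓡 n) x) ℝ (0 : Fin 1)).symm θ

/-- The 3-tensor `(X, Y, Z) ↦ g(X, Y) θ(Z) + g(X, Z) θ(Y)`. -/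
def metricProd {x : M} (θ : Tensor n 1 x) : Tensor n 3 x :=
  MultilinearMap.mk'
    (fun v => g.inner x (v 0) (v 1) * toForm θ (v 2) + g.inner x (v 0) (v 2) * toForm θ (v 1))
    (by intro m i a b; fin_cases i <;> simp <;> ring)
    (by intro m i c a; fin_cases i <;> simp <;> ring)

/-- The operator `S`:
`(Sφ)(X, Y, Z) = (∇_X φ)(Y, Z) - 1/(n+1) (g(X, Y) (div φ)(Z) + g(X, Z) (div φ)(Y))`. -/
def opS (φ : SymmTwoTensor n M) (x : M) : Tensor n 3 x :=
  covDeriv g (toTensor φ) x - (1 / ((n : ℝ) + 1)) • metricProd g (divergence g φ x)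

/-- The operator `S*`:
`(S*Φ)(Y, Z) = - trace_g (∇Φ)(·, ·, Y, Z) + 1/(n+1) ((∇_Y tr_g Φ)(Z) + (∇_Z tr_g Φ)(Y))`,
where `(tr_g Φ)(Z) = trace_g Φ(·, ·, Z)`. -/
def opSStar (Φ : (p : M) → Tensor n 3 p) (x : M) : Tensor n 2 x :=
  -metricTrace g (covDeriv g Φ x)
    + (1 / ((n : ℝ) + 1)) •
      (covDeriv g (fun p => metricTrace g (Φ p)) x
        + (covDeriv g (fun p => metricTrace g (Φ p)) x).domDomCongr (Equiv.swap 0 1))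

/-- The kernel of the operator `S*S` on `C^∞(S²T*M)`. -/
def kerSStarS : Set (SymmTwoTensor n M) :=
  {φ | ∀ x : M, opSStar g (opS g φ) x = 0}

end Riemannian

end Sinyukov

end

open scoped Manifold ContDiff Bundle

noncomputable section

set_option synthInstance.maxHeartbeats 400000

namespace Sinyukov

/-! The proof is a double use of the divergence theorem. Write `A` for the field of `g`-symmetric
endomorphisms with `g(Au, v) = φ(u, v)` and `η = (n+1)⁻¹ (div A)^♯`. Then `S` becomes `(u, v) ↦ (∇_u
A)v - g(u, v)η - g(η, v)u` (`sinOp`), and the factor `1/(n+1)` makes it trace-free, so that `S*Sφ =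
-div(Sφ)` (`opSStar_opS`).

If `S*Sφ = 0`, the vector field dual to `u ↦ tr(S_u A)` has divergence `|S|²`: the term `⟨div S, A⟩`
vanishes by hypothesis, and in `⟨S, ∇A⟩` the `η` terms only produce traces of `S`
(`traceL_covVec_pairForm`). A nonnegative divergence on a closed manifold is zero
(`vecDiv_eq_zero_of_nonneg`), hence `S = 0`, that is `(∇_u A)v = g(u, v)η + g(η, v)u`.

Differentiating this equation once more and commuting derivatives gives `integrability`. In an
orthonormal eigenbasis of `A`, with eigenvalues `μ_i` and `B = ∇η`, it reads `B_ii - B_jj = -(μ_i -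
μ_j) K_ij`, where `K_ij` is a sectional curvature (`eigen_integrability`). The field `n Aη - (tr
A)η` has divergence `½ ∑ (μ_i - μ_j)(B_ii - B_jj) + (n(n+1) - 2)|η|²` (`traceL_covVec_bochnerVec`).
For `K ≤ 0` both terms are nonnegative, so the divergence vanishes, and `n ≥ 2` forces `η = 0`;
hence `∇A = 0`.

Where `K < 0`, `η = 0` makes all `μ_i` equal, so `A = C·id` at that point. The function `tr (A -
C)²` is constant because `A` is parallel, and it vanishes only where `A = C·id`; connectedness
concludes.

All the analysis is done for a metric `G` on an open subset of a vector space. Naturality under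
local isometries (`IsIsometryAt`) makes it independent of the chart, and a separate translation
matches it with the component formulas of the definitions. -/

theorem exists_eigenbasis_of_symm {V : Type*} [AddCommGroup V] [Module ℝ V]
    [FiniteDimensional ℝ V] (b : V →ₗ[ℝ] V →ₗ[ℝ] ℝ) (hsymm : ∀ u v, b u v = b v u)
    (hpos : ∀ u, u ≠ 0 → 0 < b u u) (A : V →ₗ[ℝ] V) (hA : ∀ u v, b (A u) v = b u (A v)) :
    ∃ (e : Module.Basis (Fin (Module.finrank ℝ V)) ℝ V) (μ : Fin (Module.finrank ℝ V) → ℝ),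
      (∀ i j, b (e i) (e j) = if i = j then 1 else 0) ∧ ∀ i, A (e i) = μ i • e i := by
  have hnonneg : ∀ u, 0 ≤ b u u := fun u => by
    rcases eq_or_ne u 0 with rfl | h
    · simp
    · exact (hpos u h).le
  -- The form itself is taken as inner product, so that the spectral theorem applies. `V` carries no
  -- norm, so nothing competes with the norm induced here.
  let core : InnerProductSpace.Core ℝ V :=
    { inner := fun u v => b u v
      conj_inner_symm := fun u v => by simpa using hsymm v u
      re_inner_nonneg := fun u => by simpa using hnonneg u
      add_left := fun u v w => by simp
      smul_left := fun u v r => by simp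
      definite := fun u h => by
        by_contra hu
        exact (hpos u hu).ne' h }
  let _ : NormedAddCommGroup V := core.toNormedAddCommGroup
  let _ : InnerProductSpace ℝ V := InnerProductSpace.ofCore core.toCore
  have hs : A.IsSymmetric := fun u v => hA u v
  refine ⟨(hs.eigenvectorBasis rfl).toBasis, hs.eigenvalues rfl, fun i j => ?_, fun i => ?_⟩
  · have := (orthonormal_iff_ite.1 (hs.eigenvectorBasis rfl).orthonormal) i j
    simp only [OrthonormalBasis.coe_toBasis]
    exact this
  · simp

/-! ### Linear algebra: inner products as bilinear forms, traces, orthonormal bases. -/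

section Algebra

variable {E : Type*} [NormedAddCommGroup E] [NormedSpace ℝ E]

/-- Inner products on `E`, as continuous bilinear forms. -/
structure IsInner (b : E →L[ℝ] E →L[ℝ] ℝ) : Prop where
  symm : ∀ u v, b u v = b v u
  pos : ∀ u, u ≠ 0 → 0 < b u u

/-- The isomorphism from covectors to vectors given by a nondegenerate bilinear form. -/
def sharp (b : E →L[ℝ] E →L[ℝ] ℝ) : (E →L[ℝ] ℝ) →L[ℝ] E := b.inverse

namespace IsInner

variable {b : E →L[ℝ] E →L[ℝ] ℝ} (hb : IsInner b)
include hb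

theorem nonneg (u : E) : 0 ≤ b u u := by
  rcases eq_or_ne u 0 with rfl | h
  · simp
  · exact (hb.pos u h).le

theorem eq_zero {u : E} (h : b u u = 0) : u = 0 := by
  by_contra hu
  exact (hb.pos u hu).ne' h

theorem ext {u v : E} (h : ∀ w, b u w = b v w) : u = v := by
  rw [← sub_eq_zero]
  apply hb.eq_zero
  simp [h]

end IsInner

variable [FiniteDimensional ℝ E]

/-- The trace as a continuous linear form on endomorphisms. -/
def traceL : (E →L[ℝ] E) →L[ℝ] ℝ :=
  LinearMap.toContinuousLinearMap (LinearMap.trace ℝ E ∘ₗ ContinuousLinearMap.coeLM ℝ)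

theorem traceL_apply (F : E →L[ℝ] E) : traceL F = LinearMap.trace ℝ E (F : E →ₗ[ℝ] E) := rfl

theorem traceL_comp_comm (F H : E →L[ℝ] E) : traceL (F ∘L H) = traceL (H ∘L F) := by
  simp only [traceL_apply, ContinuousLinearMap.toLinearMap_comp]
  exact LinearMap.trace_mul_comm ℝ (F : E →ₗ[ℝ] E) (H : E →ₗ[ℝ] E)

theorem traceL_id : traceL (ContinuousLinearMap.id ℝ E) = Module.finrank ℝ E := by
  simp [traceL_apply]

theorem traceL_smulRight (α : E →L[ℝ] ℝ) (v : E) : traceL (α.smulRight v) = α v := by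
  rw [traceL_apply]
  exact LinearMap.trace_smulRight (α : E →ₗ[ℝ] ℝ) v

/-- The source of coordinate independence of traces: `L` will be the derivative of a change of
charts. -/
theorem traceL_eq_of_conj {F H : E →L[ℝ] E} (L : E ≃L[ℝ] E) (h : ∀ v, L (F v) = H (L v)) :
    traceL F = traceL H := by
  have : H = (L : E →L[ℝ] E) ∘L (F ∘L (L.symm : E →L[ℝ] E)) := by
    ext v; simp [h]
  rw [this, traceL_comp_comm]
  congr 1
  ext v; simp

namespace IsInner

variable {b : E →L[ℝ] E →L[ℝ] ℝ} (hb : IsInner b)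
include hb

/-- `ContinuousLinearMap.inverse` is zero on maps that are not invertible, so `sharp` is meaningful
only thanks to this: a definite form is injective, and a space and its dual have equal dimension. -/
theorem exists_equiv : ∃ L : E ≃L[ℝ] (E →L[ℝ] ℝ), (L : E →L[ℝ] (E →L[ℝ] ℝ)) = b := by
  have hinj : Function.Injective (b : E →ₗ[ℝ] (E →L[ℝ] ℝ)) := by
    intro u v h
    exact hb.ext fun w => by simpa using congrArg (fun f : E →L[ℝ] ℝ => f w) h
  have hdim : Module.finrank ℝ E = Module.finrank ℝ (E →L[ℝ] ℝ) := by
    rw [← (LinearMap.toContinuousLinearMap : (E →ₗ[ℝ] ℝ) ≃ₗ[ℝ] _).finrank_eq]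
    exact (Subspace.dual_finrank_eq (K := ℝ) (V := E)).symm
  refine ⟨(LinearEquiv.ofInjectiveOfFinrankEq (b : E →ₗ[ℝ] (E →L[ℝ] ℝ)) hinj hdim
    ).toContinuousLinearEquiv, ?_⟩
  ext; rfl

theorem apply_sharp (α : E →L[ℝ] ℝ) : b (sharp b α) = α := by
  obtain ⟨L, rfl⟩ := hb.exists_equiv
  simp [sharp]

/-- A basis diagonalising an endomorphism symmetric for an inner product. -/
theorem exists_eigenbasis (A : E →L[ℝ] E) (hA : ∀ u v, b (A u) v = b u (A v)) :
    ∃ (e : Module.Basis (Fin (Module.finrank ℝ E)) ℝ E) (μ : Fin (Module.finrank ℝ E) → ℝ),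
      (∀ i j, b (e i) (e j) = if i = j then 1 else 0) ∧ ∀ i, A (e i) = μ i • e i :=
  exists_eigenbasis_of_symm (b.toLinearMap₁₂) hb.symm hb.pos (A : E →ₗ[ℝ] E) hA

theorem exists_orthonormalBasis :
    ∃ e : Module.Basis (Fin (Module.finrank ℝ E)) ℝ E,
      ∀ i j, b (e i) (e j) = if i = j then 1 else 0 := by
  obtain ⟨e, -, he, -⟩ := hb.exists_eigenbasis 0 (by simp)
  exact ⟨e, he⟩

end IsInner

section Orthonormal

variable {ι : Type*} [Fintype ι] [DecidableEq ι] {b : E →L[ℝ] E →L[ℝ] ℝ}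
  {e : Module.Basis ι ℝ E}

omit [FiniteDimensional ℝ E] in
theorem repr_eq_of_orthonormal (he : ∀ i j, b (e i) (e j) = if i = j then 1 else 0) (v : E)
    (i : ι) : e.repr v i = b v (e i) := by
  conv_rhs => rw [← e.sum_repr v]
  simp only [map_sum, map_smul, sum_apply, smul_apply, he]
  simp

theorem traceL_eq_sum (he : ∀ i j, b (e i) (e j) = if i = j then 1 else 0) (F : E →L[ℝ] E) :
    traceL F = ∑ i, b (F (e i)) (e i) := by
  rw [traceL_apply, LinearMap.trace_eq_matrix_trace ℝ e, Matrix.trace]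
  simp [LinearMap.toMatrix_apply, repr_eq_of_orthonormal he]

end Orthonormal

end Algebra

/-! ### Levi-Civita calculus for a metric on an open subset of a vector space, and its naturality.
-/

section Flat

open Filter Topology

variable {E : Type*} [NormedAddCommGroup E] [NormedSpace ℝ E]

instance normedAddCommGroupBilinear {F : Type*} [NormedAddCommGroup F] [NormedSpace ℝ F] :
    NormedAddCommGroup (E →L[ℝ] E →L[ℝ] F) := inferInstance

instance normedSpaceBilinear {F : Type*} [NormedAddCommGroup F] [NormedSpace ℝ F] :
    NormedSpace ℝ (E →L[ℝ] E →L[ℝ] F) := inferInstance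

instance normedAddCommGroupTrilinear {F : Type*} [NormedAddCommGroup F] [NormedSpace ℝ F] :
    NormedAddCommGroup (E →L[ℝ] E →L[ℝ] E →L[ℝ] F) := inferInstance

instance normedSpaceTrilinear {F : Type*} [NormedAddCommGroup F] [NormedSpace ℝ F] :
    NormedSpace ℝ (E →L[ℝ] E →L[ℝ] E →L[ℝ] F) := inferInstance

/-- The right-hand side of the Koszul formula, as a function of the derivative of the metric. -/
def koszul (D : E →L[ℝ] E →L[ℝ] E →L[ℝ] ℝ) : E →L[ℝ] E →L[ℝ] E →L[ℝ] ℝ :=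
  (1 / 2 : ℝ) • (D + D.flip -
    ((ContinuousLinearMap.flipₗᵢ ℝ E E ℝ : (E →L[ℝ] E →L[ℝ] ℝ) ≃ₗᵢ[ℝ] _) :
      (E →L[ℝ] E →L[ℝ] ℝ) →L[ℝ] (E →L[ℝ] E →L[ℝ] ℝ)) ∘L D.flip)

theorem koszul_apply (D : E →L[ℝ] E →L[ℝ] E →L[ℝ] ℝ) (u v w : E) :
    koszul D u v w = 1 / 2 * (D u v w + D v u w - D w u v) := by
  simp [koszul]

/-- The Christoffel symbol of the metric `G` at `y`, as a bilinear map. -/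
def chr (G : E → E →L[ℝ] E →L[ℝ] ℝ) (y : E) : E →L[ℝ] E →L[ℝ] E :=
  ContinuousLinearMap.compL ℝ E (E →L[ℝ] ℝ) E (sharp (G y)) ∘L koszul (fderiv ℝ G y)

theorem chr_apply (G : E → E →L[ℝ] E →L[ℝ] ℝ) (y u v : E) :
    chr G y u v = sharp (G y) (koszul (fderiv ℝ G y) u v) := by
  simp [chr]

/-- The covariant derivative `(u, v) ↦ (∇_u A) v` of a field of endomorphisms. -/
def covEndo (Γ : E → E →L[ℝ] E →L[ℝ] E) (A : E → E →L[ℝ] E) (y : E) : E →L[ℝ] E →L[ℝ] E :=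
  fderiv ℝ A y + (ContinuousLinearMap.compL ℝ E E E).flip (A y) ∘L Γ y
    - ContinuousLinearMap.compL ℝ E E E (A y) ∘L Γ y

theorem covEndo_apply (Γ : E → E →L[ℝ] E →L[ℝ] E) (A : E → E →L[ℝ] E) (y u v : E) :
    covEndo Γ A y u v = fderiv ℝ A y u v + Γ y u (A y v) - A y (Γ y u v) := by
  simp [covEndo]

/-- The covariant derivative `u ↦ ∇_u X` of a vector field. -/
def covVec (Γ : E → E →L[ℝ] E →L[ℝ] E) (X : E → E) (y : E) : E →L[ℝ] E :=
  fderiv ℝ X y + (Γ y).flip (X y)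

theorem covVec_apply (Γ : E → E →L[ℝ] E →L[ℝ] E) (X : E → E) (y u : E) :
    covVec Γ X y u = fderiv ℝ X y u + Γ y u (X y) := by
  simp [covVec]

/-- The covariant derivative `(a, u, v) ↦ (∇_a N)(u, v)` of a vector-valued bilinear field. -/
def covBil (Γ : E → E →L[ℝ] E →L[ℝ] E) (N : E → E →L[ℝ] E →L[ℝ] E) (y a u v : E) : E :=
  fderiv ℝ N y a u v + Γ y a (N y u v) - N y (Γ y a u) v - N y u (Γ y a v)

/-- The curvature `R(a, u) v` of the connection `Γ`. -/
def curv (Γ : E → E →L[ℝ] E →L[ℝ] E) (y a u v : E) : E :=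
  fderiv ℝ Γ y a u v - fderiv ℝ Γ y u a v + Γ y a (Γ y u v) - Γ y u (Γ y a v)

theorem fderiv_apply_const {F : Type*} [NormedAddCommGroup F] [NormedSpace ℝ F]
    {N : E → E →L[ℝ] F} {y : E} (h : DifferentiableAt ℝ N y) (a v : E) :
    fderiv ℝ (fun z => N z v) y a = fderiv ℝ N y a v := by
  rw [fderiv_clm_apply h (differentiableAt_const v)]
  simp

theorem fderiv_apply_const₂ {F : Type*} [NormedAddCommGroup F] [NormedSpace ℝ F]
    {N : E → E →L[ℝ] E →L[ℝ] F} {y : E} (h : DifferentiableAt ℝ N y) (a u v : E) :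
    fderiv ℝ (fun z => N z u v) y a = fderiv ℝ N y a u v := by
  rw [fderiv_apply_const (h.clm_apply (differentiableAt_const u)), fderiv_apply_const h]

/-- Commutation of second covariant derivatives of a field of endomorphisms. -/
theorem covBil_covEndo_sub {Γ : E → E →L[ℝ] E →L[ℝ] E} {A : E → E →L[ℝ] E} {y : E}
    (hΓ : DifferentiableAt ℝ Γ y) (hA : ContDiffAt ℝ 2 A y) (hsymm : ∀ u v, Γ y u v = Γ y v u)
    (a u v : E) :
    covBil Γ (covEndo Γ A) y a u v - covBil Γ (covEndo Γ A) y u a v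
      = curv Γ y a u (A y v) - A y (curv Γ y a u v) := by
  have hA1 : DifferentiableAt ℝ A y := hA.differentiableAt (by norm_num)
  have hdA : DifferentiableAt ℝ (fderiv ℝ A) y :=
    (hA.fderiv_right (m := 1) (by norm_num)).differentiableAt (by norm_num)
  have hs : ∀ a u, fderiv ℝ (fderiv ℝ A) y a u = fderiv ℝ (fderiv ℝ A) y u a := fun a u =>
    hA.isSymmSndFDerivAt (by simp) a u
  have hN : DifferentiableAt ℝ (covEndo Γ A) y := by
    have h1 : DifferentiableAt ℝ (fun z => (ContinuousLinearMap.compL ℝ E E E).flip (A z)) y :=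
      (ContinuousLinearMap.compL ℝ E E E).flip.differentiableAt.comp y hA1
    have h2 : DifferentiableAt ℝ (fun z => ContinuousLinearMap.compL ℝ E E E (A z)) y :=
      (ContinuousLinearMap.compL ℝ E E E).differentiableAt.comp y hA1
    exact (hdA.add (h1.clm_comp hΓ)).sub (h2.clm_comp hΓ)
  have key : ∀ a u v, fderiv ℝ (covEndo Γ A) y a u v =
      fderiv ℝ (fderiv ℝ A) y a u v + fderiv ℝ Γ y a u (A y v) + Γ y u (fderiv ℝ A y a v)
        - fderiv ℝ A y a (Γ y u v) - A y (fderiv ℝ Γ y a u v) := by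
    intro a u v
    rw [← fderiv_apply_const₂ hN]
    simp only [covEndo_apply]
    have h1 := (hdA.hasFDerivAt.clm_apply (hasFDerivAt_const u y)).clm_apply (hasFDerivAt_const v y)
    have h2 := (hΓ.hasFDerivAt.clm_apply (hasFDerivAt_const u y)).clm_apply
      (hA1.hasFDerivAt.clm_apply (hasFDerivAt_const v y))
    have h3 := hA1.hasFDerivAt.clm_apply
      ((hΓ.hasFDerivAt.clm_apply (hasFDerivAt_const u y)).clm_apply (hasFDerivAt_const v y))
    have h4 := congrArg (fun f : E →L[ℝ] E => f a) ((h1.add h2).sub h3).fderiv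
    refine Eq.trans h4 ?_
    simp
    abel
  -- After antisymmetrisation in `a` and `u`, the second derivatives of `A` cancel by Schwarz, the
  -- terms in `Γ(a, u)` by symmetry of `Γ`, and the cross terms in pairs; the curvature remains.
  simp only [covBil, key, covEndo_apply, curv, hs a u, hsymm a u, map_add, map_sub]
  abel

variable [FiniteDimensional ℝ E]

/-- `G` is a smooth Riemannian metric on the open set `U`. -/
structure IsMetricOn (G : E → E →L[ℝ] E →L[ℝ] ℝ) (U : Set E) : Prop where
  isOpen : IsOpen U
  smooth : ContDiffOn ℝ ∞ G U
  isInner : ∀ y ∈ U, IsInner (G y)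

namespace IsMetricOn

variable {G : E → E →L[ℝ] E →L[ℝ] ℝ} {U : Set E} (hG : IsMetricOn G U) {y : E} (hy : y ∈ U)
include hG

theorem contDiffOn_sharp : ContDiffOn ℝ ∞ (fun y => sharp (G y)) U := by
  intro y hy
  obtain ⟨L, hL⟩ := (hG.isInner y hy).exists_equiv
  have h : ContDiffAt ℝ ∞ (ContinuousLinearMap.inverse : (E →L[ℝ] E →L[ℝ] ℝ) → _) (G y) := by
    rw [← hL]; exact contDiffAt_map_inverse L
  exact h.comp_contDiffWithinAt y (hG.smooth y hy)

theorem contDiffOn_chr : ContDiffOn ℝ ∞ (chr G) U := by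
  have h1 : ContDiffOn ℝ ∞ (fderiv ℝ G) U :=
    hG.smooth.fderiv_of_isOpen hG.isOpen (by simp)
  rw [contDiffOn_clm_apply]
  intro u
  rw [contDiffOn_clm_apply]
  intro v
  simp only [chr_apply]
  refine hG.contDiffOn_sharp.clm_apply ?_
  rw [contDiffOn_clm_apply]
  intro w
  simp only [koszul_apply]
  have h2 : ∀ a b c : E, ContDiffOn ℝ ∞ (fun y => fderiv ℝ G y a b c) U := fun a b c =>
    ((h1.clm_apply contDiffOn_const).clm_apply contDiffOn_const).clm_apply contDiffOn_const
  exact contDiffOn_const.mul (((h2 _ _ _).add (h2 _ _ _)).sub (h2 _ _ _))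

include hy

omit [FiniteDimensional ℝ E] in
theorem mem_nhds : U ∈ 𝓝 y := hG.isOpen.mem_nhds hy

theorem contDiffAt : ContDiffAt ℝ ∞ G y := hG.smooth.contDiffAt (hG.mem_nhds hy)

theorem differentiableAt : DifferentiableAt ℝ G y := (hG.contDiffAt hy).differentiableAt (by simp)

theorem fderiv_symm (a u v : E) : fderiv ℝ G y a u v = fderiv ℝ G y a v u := by
  rw [← fderiv_apply_const₂ (hG.differentiableAt hy),
    ← fderiv_apply_const₂ (hG.differentiableAt hy)]
  have : (fun z => G z u v) =ᶠ[𝓝 y] fun z => G z v u := by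
    filter_upwards [hG.mem_nhds hy] with z hz using (hG.isInner z hz).symm u v
  rw [this.fderiv_eq]

theorem apply_chr (u v w : E) : G y (chr G y u v) w
    = 1 / 2 * (fderiv ℝ G y u v w + fderiv ℝ G y v u w - fderiv ℝ G y w u v) := by
  rw [chr_apply, (hG.isInner y hy).apply_sharp, koszul_apply]

theorem chr_symm (u v : E) : chr G y u v = chr G y v u := by
  refine (hG.isInner y hy).ext fun w => ?_
  rw [hG.apply_chr hy, hG.apply_chr hy, hG.fderiv_symm hy w u v]
  ring

/-- Compatibility of the connection with the metric: in the sum of the Koszul formulas for `G(Γ(a,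
u), v)` and `G(Γ(a, v), u)` everything cancels but the derivative along `a`. Derivatives of `G` are
turned into Christoffel terms through it. -/
theorem fderiv_eq (a u v : E) :
    fderiv ℝ G y a u v = G y (chr G y a u) v + G y u (chr G y a v) := by
  rw [(hG.isInner y hy).symm u, hG.apply_chr hy, hG.apply_chr hy, hG.fderiv_symm hy a v u,
    hG.fderiv_symm hy v a u, hG.fderiv_symm hy u a v]
  ring

end IsMetricOn

/-- `Ψ` is a local isometry from `G` to `G'` near `y`. -/
structure IsIsometryAt (G G' : E → E →L[ℝ] E →L[ℝ] ℝ) (Ψ : E → E) (y : E) : Prop where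
  smooth : ContDiffAt ℝ ∞ Ψ y
  pullback : ∀ᶠ z in 𝓝 y, ∀ u v, G z u v = G' (Ψ z) (fderiv ℝ Ψ z u) (fderiv ℝ Ψ z v)

namespace IsIsometryAt

variable {G G' : E → E →L[ℝ] E →L[ℝ] ℝ} {Ψ : E → E} {U U' : Set E} {y : E}
  (hΨ : IsIsometryAt G G' Ψ y)
include hΨ

theorem exists_equiv (hG : IsInner (G y)) : ∃ L : E ≃L[ℝ] E, (L : E →L[ℝ] E) = fderiv ℝ Ψ y := by
  have hinj : Function.Injective (fderiv ℝ Ψ y : E →ₗ[ℝ] E) := by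
    intro u v h
    have h' : fderiv ℝ Ψ y u = fderiv ℝ Ψ y v := h
    refine hG.ext fun w => ?_
    rw [hΨ.pullback.self_of_nhds, hΨ.pullback.self_of_nhds, h']
  exact ⟨(LinearEquiv.ofInjectiveEndo _ hinj).toContinuousLinearEquiv, by ext; rfl⟩

omit [FiniteDimensional ℝ E] in
theorem differentiableAt : DifferentiableAt ℝ Ψ y := hΨ.smooth.differentiableAt (by simp)

omit [FiniteDimensional ℝ E] in
theorem differentiableAt_fderiv : DifferentiableAt ℝ (fderiv ℝ Ψ) y :=
  (hΨ.smooth.fderiv_right (m := 1) (by norm_cast)).differentiableAt (by norm_num)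

variable (hG : IsMetricOn G U) (hy : y ∈ U) (hG' : IsMetricOn G' U') (hy' : Ψ y ∈ U')
include hG hy hG' hy'

theorem fderiv_metric (a u v : E) : fderiv ℝ G y a u v =
    fderiv ℝ G' (Ψ y) (fderiv ℝ Ψ y a) (fderiv ℝ Ψ y u) (fderiv ℝ Ψ y v)
      + G' (Ψ y) (fderiv ℝ (fderiv ℝ Ψ) y a u) (fderiv ℝ Ψ y v)
      + G' (Ψ y) (fderiv ℝ Ψ y u) (fderiv ℝ (fderiv ℝ Ψ) y a v) := by
  have h1 := (hG'.differentiableAt hy').hasFDerivAt.comp y hΨ.differentiableAt.hasFDerivAt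
  have h2 := hΨ.differentiableAt_fderiv.hasFDerivAt
  have h3 := (h1.clm_apply (h2.clm_apply (hasFDerivAt_const u y))).clm_apply
    (h2.clm_apply (hasFDerivAt_const v y))
  rw [← fderiv_apply_const₂ (hG.differentiableAt hy)]
  have : (fun z => G z u v) =ᶠ[𝓝 y]
      fun z => G' (Ψ z) (fderiv ℝ Ψ z u) (fderiv ℝ Ψ z v) := by
    filter_upwards [hΨ.pullback] with z hz using hz u v
  rw [this.fderiv_eq]
  have h4 := congrArg (fun f : E →L[ℝ] ℝ => f a) h3.fderiv
  simp at h4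
  rw [h4]
  ring

/-- Transformation of the Christoffel symbols. -/
theorem fderiv_chr (u v : E) : fderiv ℝ Ψ y (chr G y u v) =
    chr G' (Ψ y) (fderiv ℝ Ψ y u) (fderiv ℝ Ψ y v) + fderiv ℝ (fderiv ℝ Ψ) y u v := by
  obtain ⟨L, hL⟩ := hΨ.exists_equiv (hG.isInner y hy)
  have hs : ∀ a u, fderiv ℝ (fderiv ℝ Ψ) y a u = fderiv ℝ (fderiv ℝ Ψ) y u a := fun a u =>
    hΨ.smooth.isSymmSndFDerivAt (by simp; norm_cast) a u
  have i := hG'.isInner _ hy'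
  refine i.ext fun w => ?_
  obtain ⟨w, rfl⟩ := L.surjective w
  have hw : L w = fderiv ℝ Ψ y w := by rw [← hL]; rfl
  rw [hw, ← hΨ.pullback.self_of_nhds, hG.apply_chr hy, map_add, add_apply,
    hG'.apply_chr hy']
  -- Of the six second-derivative terms in the Koszul combination, four cancel by Schwarz and the
  -- two involving `D²Ψ(u, v)` add up; they form the inhomogeneous term.
  simp only [hΨ.fderiv_metric hG hy hG' hy', hs w, hs v u, i.symm (fderiv ℝ Ψ y u)]
  rw [i.symm (fderiv ℝ Ψ y v)]
  ring

/-- Differentiating `dΨ ∘ A = A' ∘ dΨ` produces second derivatives of `Ψ`, which the inhomogeneous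
term in the transformation of the Christoffel symbols cancels. -/
theorem fderiv_covEndo {A A' : E → E →L[ℝ] E} (hA : DifferentiableAt ℝ A y)
    (hA' : DifferentiableAt ℝ A' (Ψ y))
    (h : ∀ᶠ z in 𝓝 y, ∀ v, fderiv ℝ Ψ z (A z v) = A' (Ψ z) (fderiv ℝ Ψ z v)) (u v : E) :
    fderiv ℝ Ψ y (covEndo (chr G) A y u v)
      = covEndo (chr G') A' (Ψ y) (fderiv ℝ Ψ y u) (fderiv ℝ Ψ y v) := by
  have hΓ := hΨ.fderiv_chr hG hy hG' hy'
  have h2 := hΨ.differentiableAt_fderiv.hasFDerivAt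
  have h3 := h2.clm_apply (hA.hasFDerivAt.clm_apply (hasFDerivAt_const v y))
  have h4 := (hA'.hasFDerivAt.comp y hΨ.differentiableAt.hasFDerivAt).clm_apply
    (h2.clm_apply (hasFDerivAt_const v y))
  have h5 : (fun z => fderiv ℝ Ψ z (A z v)) =ᶠ[𝓝 y] fun z => A' (Ψ z) (fderiv ℝ Ψ z v) := by
    filter_upwards [h] with z hz using hz v
  have h6 := congrArg (fun f : E →L[ℝ] E => f u) (h3.unique (h4.congr_of_eventuallyEq h5))
  have h0 := h.self_of_nhds
  simp at h6
  simp only [covEndo_apply, map_add, map_sub, hΓ, h0]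
  rw [eq_sub_of_add_eq h6]
  abel

theorem fderiv_covVec {X X' : E → E} (hX : DifferentiableAt ℝ X y)
    (hX' : DifferentiableAt ℝ X' (Ψ y))
    (h : ∀ᶠ z in 𝓝 y, fderiv ℝ Ψ z (X z) = X' (Ψ z)) (u : E) :
    fderiv ℝ Ψ y (covVec (chr G) X y u) = covVec (chr G') X' (Ψ y) (fderiv ℝ Ψ y u) := by
  have hΓ := hΨ.fderiv_chr hG hy hG' hy'
  have h2 := hΨ.differentiableAt_fderiv.hasFDerivAt
  have h3 := h2.clm_apply hX.hasFDerivAt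
  have h4 := hX'.hasFDerivAt.comp y hΨ.differentiableAt.hasFDerivAt
  have h6 := congrArg (fun f : E →L[ℝ] E => f u) (h3.unique (h4.congr_of_eventuallyEq h))
  have h0 := h.self_of_nhds
  simp at h6
  simp only [covVec_apply, map_add, hΓ, h0, ← h6]
  abel

theorem traceL_covVec {X X' : E → E} (hX : DifferentiableAt ℝ X y)
    (hX' : DifferentiableAt ℝ X' (Ψ y))
    (h : ∀ᶠ z in 𝓝 y, fderiv ℝ Ψ z (X z) = X' (Ψ z)) :
    traceL (covVec (chr G) X y) = traceL (covVec (chr G') X' (Ψ y)) := by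
  obtain ⟨L, hL⟩ := hΨ.exists_equiv (hG.isInner y hy)
  refine traceL_eq_of_conj L fun v => ?_
  have := hΨ.fderiv_covVec hG hy hG' hy' hX hX' h v
  rw [← hL] at this
  exact this

end IsIsometryAt

end Flat

/-! ### The operator `S` on endomorphism fields, and the identity `div (tr (S A)) = |S|²`. -/

section LocalSinyukov

open Filter Topology

variable {E : Type*} [NormedAddCommGroup E] [NormedSpace ℝ E]

theorem traceL_comp_smulRight [FiniteDimensional ℝ E] (F : E →L[ℝ] E) (α : E →L[ℝ] ℝ) (v : E) :
    traceL (F ∘L α.smulRight v) = α (F v) := by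
  have : F ∘L α.smulRight v = α.smulRight (F v) := by ext w; simp
  rw [this, traceL_smulRight]

/-- The divergence `w ↦ tr (u ↦ (∇_u A) w)` of a field of endomorphisms. -/
def divEndo [FiniteDimensional ℝ E] (G : E → E →L[ℝ] E →L[ℝ] ℝ) (A : E → E →L[ℝ] E) (y : E) :
    E →L[ℝ] ℝ :=
  traceL ∘L (covEndo (chr G) A y).flip

theorem divEndo_apply [FiniteDimensional ℝ E] (G : E → E →L[ℝ] E →L[ℝ] ℝ) (A : E → E →L[ℝ] E)
    (y w : E) : divEndo G A y w = traceL ((covEndo (chr G) A y).flip w) := rfl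

/-- The vector field `(n + 1)⁻¹ (div A)^♯`. -/
def divVec [FiniteDimensional ℝ E] (G : E → E →L[ℝ] E →L[ℝ] ℝ) (A : E → E →L[ℝ] E) (y : E) : E :=
  (1 / ((Module.finrank ℝ E : ℝ) + 1)) • sharp (G y) (divEndo G A y)

/-- The bilinear map `(u, v) ↦ b(u, v) η + b(η, v) u`. -/
def symProd (b : E →L[ℝ] E →L[ℝ] ℝ) (η : E) : E →L[ℝ] E →L[ℝ] E :=
  (ContinuousLinearMap.smulRightL ℝ E E).flip η ∘L b +
    ContinuousLinearMap.smulRightL ℝ E E (b η)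

theorem symProd_apply (b : E →L[ℝ] E →L[ℝ] ℝ) (η u v : E) :
    symProd b η u v = b u v • η + b η v • u := by
  simp [symProd]

theorem symProd_left (b : E →L[ℝ] E →L[ℝ] ℝ) (η u : E) :
    symProd b η u = (b u).smulRight η + (b η).smulRight u := by
  ext v; simp [symProd_apply]

/-- The operator `S` on fields of endomorphisms. -/
def sinOp [FiniteDimensional ℝ E] (G : E → E →L[ℝ] E →L[ℝ] ℝ) (A : E → E →L[ℝ] E) (y : E) :
    E →L[ℝ] E →L[ℝ] E :=
  covEndo (chr G) A y - symProd (G y) (divVec G A y)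

/-- The 1-form `u ↦ tr (S_u A)`. -/
def pairForm [FiniteDimensional ℝ E] (G : E → E →L[ℝ] E →L[ℝ] ℝ) (A : E → E →L[ℝ] E) (y : E) :
    E →L[ℝ] ℝ :=
  traceL ∘L (ContinuousLinearMap.compL ℝ E E E).flip (A y) ∘L sinOp G A y

theorem pairForm_apply [FiniteDimensional ℝ E] (G : E → E →L[ℝ] E →L[ℝ] ℝ) (A : E → E →L[ℝ] E)
    (y u : E) : pairForm G A y u = traceL (sinOp G A y u ∘L A y) := rfl

variable [FiniteDimensional ℝ E] {G : E → E →L[ℝ] E →L[ℝ] ℝ} {U : Set E} {A : E → E →L[ℝ] E}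
  {y : E}

theorem IsMetricOn.metric_covVec (hG : IsMetricOn G U) (hy : y ∈ U) {X : E → E}
    (hX : DifferentiableAt ℝ X y) (a u : E) :
    G y (covVec (chr G) X y a) u
      = fderiv ℝ (fun z => G z (X z) u) y a - G y (X y) (chr G y a u) := by
  have h := ((hG.differentiableAt hy).hasFDerivAt.clm_apply hX.hasFDerivAt).clm_apply
    (hasFDerivAt_const u y)
  have h2 := congrArg (fun f : E →L[ℝ] ℝ => f a) h.fderiv
  rw [h2]
  simp [covVec_apply, hG.fderiv_eq hy]
  ring

/-- `A` is a smooth field of `G`-symmetric endomorphisms on `U`. -/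
structure IsSymmOn (G : E → E →L[ℝ] E →L[ℝ] ℝ) (A : E → E →L[ℝ] E) (U : Set E) : Prop where
  smooth : ContDiffOn ℝ ∞ A U
  symm : ∀ y ∈ U, ∀ u v, G y (A y u) v = G y u (A y v)

variable (hG : IsMetricOn G U) (hA : IsSymmOn G A U) (hy : y ∈ U)

section
include hG hy

theorem metric_divVec (v : E) :
    G y (divVec G A y) v = (1 / ((Module.finrank ℝ E : ℝ) + 1)) * divEndo G A y v := by
  simp [divVec, (hG.isInner y hy).apply_sharp]

/-- The term `G(u, v)η` has trace `G(η, v)` in `u`, and `G(η, v)u` contributes the dimension times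
`G(η, v)`. This is the origin of the factor `1/(n+1)`. -/
theorem traceL_symProd_flip (η v : E) :
    traceL ((symProd (G y) η).flip v) = ((Module.finrank ℝ E : ℝ) + 1) * G y η v := by
  have : (symProd (G y) η).flip v = (G y v).smulRight η + G y η v • ContinuousLinearMap.id ℝ E := by
    ext u
    simp [symProd_apply, (hG.isInner y hy).symm u v]
  rw [this, map_add, map_smul, traceL_id, traceL_smulRight, (hG.isInner y hy).symm v, smul_eq_mul]
  ring

theorem sinOp_eq_zero_of_sum {ι : Type*} [Fintype ι] {e : Module.Basis ι ℝ E}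
    (h : ∑ i, ∑ j, G y (sinOp G A y (e i) (e j)) (sinOp G A y (e i) (e j)) = 0) :
    sinOp G A y = 0 := by
  have hI := hG.isInner y hy
  rw [Finset.sum_eq_zero_iff_of_nonneg
    fun i _ => Finset.sum_nonneg fun j _ => hI.nonneg _] at h
  have h' : ∀ i j, sinOp G A y (e i) (e j) = 0 := fun i j =>
    hI.eq_zero ((Finset.sum_eq_zero_iff_of_nonneg fun j _ => hI.nonneg _).1
      (h i (Finset.mem_univ i)) j (Finset.mem_univ j))
  have : ∀ i, (sinOp G A y (e i) : E →ₗ[ℝ] E) = 0 := fun i => e.ext fun j => by simpa using h' i j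
  have h2 : (sinOp G A y : E →ₗ[ℝ] E →L[ℝ] E) = 0 :=
    e.ext fun i => by
      ext v
      simpa using congrArg (fun f : E →ₗ[ℝ] E => f v) (this i)
  ext u v
  simpa using congrArg (fun f : E →ₗ[ℝ] E →L[ℝ] E => f u v) h2

/-- The normalisation of `divVec` is chosen for this. Trace-freeness removes the second term of `S*`
and the `η` terms in the pairing of `S` with `∇A`. -/
theorem traceL_sinOp_flip (v : E) : traceL ((sinOp G A y).flip v) = 0 := by
  have : (sinOp G A y).flip v =
      (covEndo (chr G) A y).flip v - (symProd (G y) (divVec G A y)).flip v := by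
    ext u; simp [sinOp]
  rw [this, map_sub, traceL_symProd_flip hG hy, metric_divVec hG hy, ← divEndo_apply]
  field_simp
  simp

end

section
include hG hA

theorem contDiffOn_covEndo : ContDiffOn ℝ ∞ (covEndo (chr G) A) U := by
  rw [contDiffOn_clm_apply]
  intro u
  rw [contDiffOn_clm_apply]
  intro v
  simp only [covEndo_apply]
  have h1 : ContDiffOn ℝ ∞ (fderiv ℝ A) U := hA.smooth.fderiv_of_isOpen hG.isOpen (by simp)
  have h2 := hG.contDiffOn_chr
  exact (((h1.clm_apply contDiffOn_const).clm_apply contDiffOn_const).add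
    ((h2.clm_apply contDiffOn_const).clm_apply (hA.smooth.clm_apply contDiffOn_const))).sub
    (hA.smooth.clm_apply ((h2.clm_apply contDiffOn_const).clm_apply contDiffOn_const))

theorem contDiffOn_divVec : ContDiffOn ℝ ∞ (divVec G A) U := by
  refine contDiffOn_const.smul (hG.contDiffOn_sharp.clm_apply ?_)
  have : ContDiff ℝ ∞ (fun D : E →L[ℝ] E →L[ℝ] E => D.flip) :=
    (ContinuousLinearMap.flipₗᵢ ℝ E E E).contDiff
  exact contDiffOn_const.clm_comp (this.comp_contDiffOn (contDiffOn_covEndo hG hA))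

theorem contDiffOn_sinOp : ContDiffOn ℝ ∞ (sinOp G A) U := by
  refine (contDiffOn_covEndo hG hA).sub ?_
  rw [contDiffOn_clm_apply]
  intro u
  rw [contDiffOn_clm_apply]
  intro v
  simp only [symProd_apply]
  have h := contDiffOn_divVec hG hA
  exact (((hG.smooth.clm_apply contDiffOn_const).clm_apply contDiffOn_const).smul h).add
    (((hG.smooth.clm_apply h).clm_apply contDiffOn_const).smul contDiffOn_const)

theorem contDiffOn_pairForm : ContDiffOn ℝ ∞ (pairForm G A) U :=
  contDiffOn_const.clm_comp
    (((ContinuousLinearMap.compL ℝ E E E).flip.contDiff.comp_contDiffOn hA.smooth).clm_comp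
      (contDiffOn_sinOp hG hA))

include hy

theorem symmEndo_differentiableAt : DifferentiableAt ℝ A y :=
  (hA.smooth.contDiffAt (hG.mem_nhds hy)).differentiableAt (by simp)

/-- The derivative of `G(Av, w) = G(v, Aw)`: the connection being metric, symmetry passes from `A`
to `∇_u A`. -/
theorem covEndo_symm (u v w : E) :
    G y (covEndo (chr G) A y u v) w = G y v (covEndo (chr G) A y u w) := by
  have dG := (hG.differentiableAt hy).hasFDerivAt
  have dA := (symmEndo_differentiableAt hG hA hy).hasFDerivAt
  have h1 := (dG.clm_apply (dA.clm_apply (hasFDerivAt_const v y))).clm_apply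
    (hasFDerivAt_const w y)
  have h2 := (dG.clm_apply (hasFDerivAt_const v y)).clm_apply
    (dA.clm_apply (hasFDerivAt_const w y))
  have h3 : (fun z => G z (A z v) w) =ᶠ[𝓝 y] fun z => G z v (A z w) := by
    filter_upwards [hG.mem_nhds hy] with z hz using hA.symm z hz v w
  have h6 := congrArg (fun f : E →L[ℝ] ℝ => f u) (h1.unique (h2.congr_of_eventuallyEq h3))
  simp [hG.fderiv_eq hy] at h6
  simp only [covEndo_apply, map_add, map_sub, add_apply, sub_apply, hA.symm y hy]
  have e1 := hA.symm y hy v (chr G y u w)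
  have e2 := hA.symm y hy (chr G y u v) w
  linarith

theorem sinOp_symm (u v w : E) : G y (sinOp G A y u v) w = G y v (sinOp G A y u w) := by
  simp only [sinOp, sub_apply, map_sub, covEndo_symm hG hA hy, symProd_apply,
    map_add, map_smul, add_apply, smul_apply, smul_eq_mul]
  rw [(hG.isInner y hy).symm v (divVec G A y), (hG.isInner y hy).symm v u]
  ring

end

section Pairing

variable {ι : Type*} [Fintype ι] [DecidableEq ι] {e : Module.Basis ι ℝ E}
  (he : ∀ i j, G y (e i) (e j) = if i = j then 1 else 0)
include hG hA hy he

/-- The pointwise identity `div (tr (S A)) = |S|²` on the kernel of `S* S`. -/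
theorem traceL_covVec_pairForm
    (hdiv : ∀ v w, ∑ i, G y (covBil (chr G) (sinOp G A) y (e i) (e i) v) w = 0) :
    traceL (covVec (chr G) (fun z => sharp (G z) (pairForm G A z)) y)
      = ∑ i, ∑ j, G y (sinOp G A y (e i) (e j)) (sinOp G A y (e i) (e j)) := by
  have hN := hG.mem_nhds hy
  have dA := (symmEndo_differentiableAt hG hA hy).hasFDerivAt
  have dS := (((contDiffOn_sinOp hG hA).contDiffAt hN).differentiableAt (by simp)).hasFDerivAt
  have dX : DifferentiableAt ℝ (fun z => sharp (G z) (pairForm G A z)) y :=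
    ((hG.contDiffOn_sharp.clm_apply (contDiffOn_pairForm hG hA)).contDiffAt hN).differentiableAt
      (by simp)
  have hI := hG.isInner y hy
  -- Leibniz rule for `tr(S_u A)`: one term differentiates `S`, the other `A`. For `a = u = e_i`,
  -- summed over `i`, the first pairs `div S` with `A` and vanishes by `hdiv`.
  have key : ∀ a u, G y (covVec (chr G) (fun z => sharp (G z) (pairForm G A z)) y a) u
      = ∑ j, G y (covBil (chr G) (sinOp G A) y a u (A y (e j))) (e j)
        + traceL (sinOp G A y u ∘L covEndo (chr G) A y a) := by
    intro a u
    rw [hG.metric_covVec hy dX, hI.apply_sharp]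
    have h1 : (fun z => G z (sharp (G z) (pairForm G A z)) u) =ᶠ[𝓝 y]
        fun z => traceL (sinOp G A z u ∘L A z) := by
      filter_upwards [hN] with z hz
      rw [(hG.isInner z hz).apply_sharp, pairForm_apply]
    rw [h1.fderiv_eq]
    have h2 := (hasFDerivAt_const (traceL (E := E)) y).clm_apply
      ((dS.clm_apply (hasFDerivAt_const u y)).clm_comp dA)
    have h3 := congrArg (fun f : E →L[ℝ] ℝ => f a) h2.fderiv
    rw [h3]
    have h4 : ∑ j, G y (covBil (chr G) (sinOp G A) y a u (A y (e j))) (e j)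
        = traceL ((fderiv ℝ (sinOp G A) y a u + chr G y a ∘L sinOp G A y u
          - sinOp G A y (chr G y a u) - sinOp G A y u ∘L chr G y a) ∘L A y) := by
      rw [traceL_eq_sum he]
      simp [covBil]
    have h5 : covEndo (chr G) A y a
        = fderiv ℝ A y a + chr G y a ∘L A y - A y ∘L chr G y a := by
      ext v; simp [covEndo_apply]
    rw [h4, h5, pairForm_apply]
    simp only [ContinuousLinearMap.add_comp, ContinuousLinearMap.sub_comp,
      ContinuousLinearMap.comp_add, ContinuousLinearMap.comp_sub, map_add, map_sub]
    -- By cyclicity of the trace the Christoffel terms of `∇S` and `∇A` cancel each other, except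
    -- for the one in `Γ(a, u)` that belongs to the derivative of the 1-form.
    have h6 : traceL ((chr G y a ∘L sinOp G A y u) ∘L A y)
        = traceL (sinOp G A y u ∘L A y ∘L chr G y a) := by
      rw [ContinuousLinearMap.comp_assoc, traceL_comp_comm, ContinuousLinearMap.comp_assoc]
    rw [h6, ContinuousLinearMap.comp_assoc (sinOp G A y u) (chr G y a) (A y)]
    simp
    ring
  rw [traceL_eq_sum he]
  simp only [key, Finset.sum_add_distrib]
  rw [Finset.sum_comm]
  simp only [hdiv, Finset.sum_const_zero, zero_add]
  -- `∇A` is split into `S` and the `η` terms. Paired with `S`, the latter give `2 G(S(e_i, η),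
  -- e_i)`, whose sum over `i` is a trace of `S`, so that only `|S|²` survives.
  have h7 : ∀ u, covEndo (chr G) A y u = sinOp G A y u +
      ((G y u).smulRight (divVec G A y) + (G y (divVec G A y)).smulRight u) := by
    intro u
    rw [← symProd_left]
    simp [sinOp]
  have h8 : ∀ v, ∑ i, G y (sinOp G A y (e i) v) (e i) = 0 := by
    intro v
    rw [← traceL_sinOp_flip (A := A) hG hy v, traceL_eq_sum he]
    simp
  have h9 : ∀ i, traceL (sinOp G A y (e i) ∘L covEndo (chr G) A y (e i))
      = ∑ j, G y (sinOp G A y (e i) (e j)) (sinOp G A y (e i) (e j))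
        + 2 * G y (sinOp G A y (e i) (divVec G A y)) (e i) := by
    intro i
    rw [h7, ContinuousLinearMap.comp_add, ContinuousLinearMap.comp_add, map_add, map_add,
      traceL_comp_smulRight, traceL_comp_smulRight, traceL_eq_sum he]
    rw [hI.symm (divVec G A y), sinOp_symm hG hA hy (e i) (e i), hI.symm (e i)]
    simp only [ContinuousLinearMap.comp_apply, sinOp_symm hG hA hy]
    ring
  simp only [h9, Finset.sum_add_distrib, ← Finset.mul_sum, h8]
  ring

end Pairing

end LocalSinyukov

/-! ### The equation `S = 0`: integrability, the Bochner argument, and parallel endomorphisms. -/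

section Vanishing

open Filter Topology

variable {E : Type*} [NormedAddCommGroup E] [NormedSpace ℝ E] [FiniteDimensional ℝ E]
  {G : E → E →L[ℝ] E →L[ℝ] ℝ} {U : Set E} {A : E → E →L[ℝ] E} {y : E}

/-- `∇_u A` and the ordinary derivative differ by a commutator with `Γ_u`, which has no trace. -/
theorem traceL_covEndo (G : E → E →L[ℝ] E →L[ℝ] ℝ) (A : E → E →L[ℝ] E) (y u : E) :
    traceL (covEndo (chr G) A y u) = traceL (fderiv ℝ A y u) := by
  have : covEndo (chr G) A y u
      = fderiv ℝ A y u + chr G y u ∘L A y - A y ∘L chr G y u := by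
    ext v; simp [covEndo_apply]
  rw [this, map_sub, map_add, traceL_comp_comm (A y)]
  ring

/-- The vector field `n A η - (tr A) η`, where `η = (n + 1)⁻¹ (div A)^♯`. -/
def bochnerVec (G : E → E →L[ℝ] E →L[ℝ] ℝ) (A : E → E →L[ℝ] E) (y : E) : E :=
  (Module.finrank ℝ E : ℝ) • A y (divVec G A y) - traceL (A y) • divVec G A y

theorem covEndo_eq_symProd (h : sinOp G A y = 0) :
    covEndo (chr G) A y = symProd (G y) (divVec G A y) :=
  sub_eq_zero.1 h

omit [FiniteDimensional ℝ E] in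
theorem curv_smul (Γ : E → E →L[ℝ] E →L[ℝ] E) (y a u b : E) (m : ℝ) :
    curv Γ y a u (m • b) = m • curv Γ y a u b := by
  simp only [curv, map_smul, smul_sub, smul_add]

variable (hG : IsMetricOn G U) (hA : IsSymmOn G A U) (hy : y ∈ U)
include hG hA

theorem contDiffOn_bochnerVec : ContDiffOn ℝ ∞ (bochnerVec G A) U :=
  ((hA.smooth.clm_apply (contDiffOn_divVec hG hA)).const_smul _).sub
    ((contDiffOn_const.clm_apply hA.smooth).smul (contDiffOn_divVec hG hA))

include hy

theorem curv_comm (a u v : E) : covBil (chr G) (covEndo (chr G) A) y a u v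
      - covBil (chr G) (covEndo (chr G) A) y u a v
    = curv (chr G) y a u (A y v) - A y (curv (chr G) y a u v) := by
  refine covBil_covEndo_sub ?_ ?_ (hG.chr_symm hy) a u v
  · exact ((hG.contDiffOn_chr.contDiffAt (hG.mem_nhds hy)).differentiableAt (by simp))
  · exact (hA.smooth.contDiffAt (hG.mem_nhds hy)).of_le (by norm_cast)

theorem divVec_differentiableAt : DifferentiableAt ℝ (divVec G A) y :=
  ((contDiffOn_divVec hG hA).contDiffAt (hG.mem_nhds hy)).differentiableAt (by simp)

variable (hS : ∀ z ∈ U, sinOp G A z = 0)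
include hS

/-- The covariant derivative of `(∇_u A)v = G(u, v)η + G(η, v)u`, which holds on an open set; since
the metric is parallel, only `η` is differentiated. -/
theorem metric_covBil (a u v w : E) : G y (covBil (chr G) (covEndo (chr G) A) y a u v) w
    = G y u v * G y (covVec (chr G) (divVec G A) y a) w
      + G y (covVec (chr G) (divVec G A) y a) v * G y u w := by
  have hN := hG.mem_nhds hy
  have dη := divVec_differentiableAt hG hA hy
  have dN : DifferentiableAt ℝ (covEndo (chr G) A) y :=
    ((contDiffOn_covEndo hG hA).contDiffAt hN).differentiableAt (by simp)
  have dG := (hG.differentiableAt hy).hasFDerivAt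
  have h1 : (fun z => covEndo (chr G) A z u v) =ᶠ[𝓝 y]
      fun z => G z u v • divVec G A z + G z (divVec G A z) v • u := by
    filter_upwards [hN] with z hz
    rw [covEndo_eq_symProd (hS z hz), symProd_apply]
  have h2 := (((dG.clm_apply (hasFDerivAt_const u y)).clm_apply (hasFDerivAt_const v y)).smul
    dη.hasFDerivAt).add
    (((dG.clm_apply dη.hasFDerivAt).clm_apply (hasFDerivAt_const v y)).smul
      (hasFDerivAt_const u y))
  have h3 := congrArg (fun f : E →L[ℝ] E => f a) (h2.congr_of_eventuallyEq h1).fderiv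
  have h4 : fderiv ℝ (covEndo (chr G) A) y a u v = _ := (fderiv_apply_const₂ dN a u v).symm.trans h3
  simp only [covBil, h4, covEndo_eq_symProd (hS y hy), symProd_apply, covVec_apply]
  simp [hG.fderiv_eq hy]
  ring

/-- The integrability condition of the Sinyukov equation. -/
theorem integrability (a u v w : E) :
    G y u v * G y (covVec (chr G) (divVec G A) y a) w
      + G y (covVec (chr G) (divVec G A) y a) v * G y u w
      - (G y a v * G y (covVec (chr G) (divVec G A) y u) w
        + G y (covVec (chr G) (divVec G A) y u) v * G y a w)
      = G y (curv (chr G) y a u (A y v)) w - G y (curv (chr G) y a u v) (A y w) := by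
  -- The antisymmetrised second derivative of `A` is evaluated in two ways: by the equation `S = 0`,
  -- and by commutation of derivatives.
  rw [← metric_covBil hG hA hy hS, ← metric_covBil hG hA hy hS, ← hA.symm y hy,
    ← sub_apply, ← map_sub, curv_comm hG hA hy, map_sub, sub_apply]

section Eigenbasis

variable {ι : Type*} [Fintype ι] [DecidableEq ι] {e : Module.Basis ι ℝ E}
  (he : ∀ i j, G y (e i) (e j) = if i = j then 1 else 0) {μ : ι → ℝ}
  (hμ : ∀ i, A y (e i) = μ i • e i)
include he hμ

omit [Fintype ι] in
-- The integrability condition at `(e_i, e_j, e_i, e_j)`: orthogonality removes the mixed terms on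
-- the left, and on the right `A` acts by `μ_i` and `μ_j`, leaving `μ_i - μ_j` times the sectional
-- curvature of the plane of `e_i` and `e_j`, up to sign.
theorem eigen_integrability {i j : ι} (hij : i ≠ j) :
    G y (covVec (chr G) (divVec G A) y (e i)) (e i)
      - G y (covVec (chr G) (divVec G A) y (e j)) (e j)
    = -((μ i - μ j) * G y (curv (chr G) y (e j) (e i) (e i)) (e j)) := by
  have h := integrability hG hA hy hS (e i) (e j) (e i) (e j)
  have hc : curv (chr G) y (e i) (e j) (e i) = -curv (chr G) y (e j) (e i) (e i) := by
    simp only [curv]; abel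
  rw [hμ i, curv_smul, hμ j, hc] at h
  simp [he, hij, hij.symm] at h
  linarith

/-- When `S = 0`, `u ↦ (∇_u A)η` has trace `(n+1)|η|²` and `d(tr A) = 2 G(η, ·)`, whence the
coefficient `n(n+1) - 2`. The rest, `n tr(AB) - tr A · tr B` with `B = ∇η`, is a covariance: in an
eigenbasis it is half the sum of the products of differences. The combination in `bochnerVec` is
made for that. -/
theorem traceL_covVec_bochnerVec :
    traceL (covVec (chr G) (bochnerVec G A) y)
      = (1 / 2) * ∑ i, ∑ j, (μ i - μ j) * (G y (covVec (chr G) (divVec G A) y (e i)) (e i)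
          - G y (covVec (chr G) (divVec G A) y (e j)) (e j))
        + ((Module.finrank ℝ E : ℝ) * (Module.finrank ℝ E + 1) - 2)
          * G y (divVec G A y) (divVec G A y) := by
  set η := divVec G A y with hη
  set B := covVec (chr G) (divVec G A) y with hB
  set n : ℝ := (Module.finrank ℝ E : ℝ) with hn
  have hI := hG.isInner y hy
  have dη := (divVec_differentiableAt hG hA hy).hasFDerivAt
  have dA := (symmEndo_differentiableAt hG hA hy).hasFDerivAt
  have hNη := covEndo_eq_symProd (hS y hy)
  have h1 := ((dA.clm_apply dη).const_smul n).sub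
    (((hasFDerivAt_const (traceL (E := E)) y).clm_apply dA).smul dη)
  have htr : ∀ u, traceL (fderiv ℝ A y u) = 2 * G y η u := by
    intro u
    rw [← traceL_covEndo G, hNη, symProd_left, map_add, traceL_smulRight, traceL_smulRight,
      hI.symm u]
    ring
  have h2 : covVec (chr G) (bochnerVec G A) y
      = n • ((symProd (G y) η).flip η + A y ∘L B) - ((2 : ℝ) • (G y η).smulRight η
        + traceL (A y) • B) := by
    ext u
    have h3 := congrArg (fun f : E →L[ℝ] E => f u) h1.fderiv
    have h4 : fderiv ℝ (bochnerVec G A) y u = _ := h3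
    rw [covVec_apply, h4]
    have h5 : fderiv ℝ A y u η = symProd (G y) η u η - chr G y u (A y η) + A y (chr G y u η) := by
      rw [← hNη, covEndo_apply]; abel
    simp [h5, htr, hB, covVec_apply, bochnerVec, ← hη, ← hn, smul_smul]
    module
  have hb : ∀ i, G y (A y (B (e i))) (e i) = μ i * G y (B (e i)) (e i) := by
    intro i
    rw [hA.symm y hy, hμ, map_smul, smul_eq_mul]
  have h6 : traceL (A y) = ∑ i, μ i := by
    rw [traceL_eq_sum he]
    simp [hμ, he]
  have hcard : (Fintype.card ι : ℝ) = n := by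
    rw [hn, Module.finrank_eq_card_basis e]
  rw [h2]
  simp only [map_add, map_sub, map_smul, smul_eq_mul, traceL_symProd_flip hG hy, traceL_smulRight,
    h6]
  rw [traceL_eq_sum he B, traceL_eq_sum he (A y ∘L B)]
  simp only [ContinuousLinearMap.comp_apply, hb]
  simp only [mul_sub, sub_mul, Finset.sum_sub_distrib, Finset.sum_const, Finset.card_univ,
    nsmul_eq_mul, ← Finset.mul_sum, ← Finset.sum_mul, hcard]
  ring

end Eigenbasis

/-- Under nonpositive curvature, the divergence of `bochnerVec` controls `|div A|²`. -/
theorem le_traceL_covVec_bochnerVec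
    (hsec : ∀ u v, LinearIndependent ℝ ![u, v] → G y (curv (chr G) y u v v) u ≤ 0) :
    ((Module.finrank ℝ E : ℝ) * (Module.finrank ℝ E + 1) - 2) * G y (divVec G A y) (divVec G A y)
      ≤ traceL (covVec (chr G) (bochnerVec G A) y) := by
  obtain ⟨e, μ, he, hμ⟩ := (hG.isInner y hy).exists_eigenbasis (A y) (hA.symm y hy)
  rw [traceL_covVec_bochnerVec hG hA hy hS he hμ]
  suffices h : 0 ≤ ∑ i, ∑ j, (μ i - μ j) * (G y (covVec (chr G) (divVec G A) y (e i)) (e i)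
      - G y (covVec (chr G) (divVec G A) y (e j)) (e j)) by linarith
  refine Finset.sum_nonneg fun i _ => Finset.sum_nonneg fun j _ => ?_
  rcases eq_or_ne i j with rfl | hij
  · simp
  -- The summand becomes `-(μ_i - μ_j)²` times a curvature term that is nonpositive by hypothesis.
  rw [eigen_integrability hG hA hy hS he hμ hij]
  have hli : LinearIndependent ℝ ![e j, e i] := by
    have := e.linearIndependent.comp ![j, i] (by
      intro a b; fin_cases a <;> fin_cases b <;> simp [hij, hij.symm])
    convert this using 1
    ext a; fin_cases a <;> rfl
  nlinarith [hsec _ _ hli, sq_nonneg (μ i - μ j)]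

/-- At a point of negative curvature, a parallel symmetric endomorphism is a homothety. -/
theorem exists_eq_smul_of_neg (hη : ∀ z ∈ U, divVec G A z = 0)
    (hsec : ∀ u v, LinearIndependent ℝ ![u, v] → G y (curv (chr G) y u v v) u < 0) :
    ∃ C : ℝ, ∀ v, A y v = C • v := by
  obtain ⟨e, μ, he, hμ⟩ := (hG.isInner y hy).exists_eigenbasis (A y) (hA.symm y hy)
  have hB : covVec (chr G) (divVec G A) y = 0 := by
    have h1 : divVec G A =ᶠ[𝓝 y] fun _ => 0 := by
      filter_upwards [hG.mem_nhds hy] with z hz using hη z hz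
    ext u
    rw [covVec_apply, h1.fderiv_eq, hη y hy]
    simp
  have hconst : ∀ i j, μ i = μ j := by
    intro i j
    rcases eq_or_ne i j with rfl | hij
    · rfl
    have h := eigen_integrability hG hA hy hS he hμ hij
    have hli : LinearIndependent ℝ ![e j, e i] := by
      have := e.linearIndependent.comp ![j, i] (by
        intro a b; fin_cases a <;> fin_cases b <;> simp [hij, hij.symm])
      convert this using 1
      ext a; fin_cases a <;> rfl
    -- With `∇η = 0`, integrability says that `μ_i - μ_j` times a nonzero curvature is zero.
    rw [hB] at h
    simp [(hsec _ _ hli).ne, sub_eq_zero] at h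
    exact h
  rcases isEmpty_or_nonempty (Fin (Module.finrank ℝ E)) with hE | ⟨⟨i₀⟩⟩
  · refine ⟨0, fun v => e.repr.injective (Finsupp.ext fun i => (hE.false i).elim)⟩
  · refine ⟨μ i₀, fun v => ?_⟩
    have : (A y : E →ₗ[ℝ] E) = μ i₀ • LinearMap.id := e.ext fun i => by simp [hμ, hconst i i₀]
    simpa using congrArg (fun f : E →ₗ[ℝ] E => f v) this

omit hG hA hy hS

/-- For a parallel `A` the ordinary derivative is the commutator `[A, Γ_u]`, and its product with `A
- C·id` is trace-free by cyclicity. The trace of the square is used because it is a scalar that does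
not depend on the chart. -/
theorem fderiv_traceL_sq_eq_zero (hA : DifferentiableAt ℝ A y) (hN : covEndo (chr G) A y = 0)
    (C : ℝ) : fderiv ℝ (fun z => traceL ((A z - C • ContinuousLinearMap.id ℝ E) ∘L
      (A z - C • ContinuousLinearMap.id ℝ E))) y = 0 := by
  have h0 := hA.hasFDerivAt.sub_const (C • ContinuousLinearMap.id ℝ E)
  have h1 := ((hasFDerivAt_const (traceL (E := E)) y).clm_apply (h0.clm_comp h0)).fderiv
  ext u
  have h2 := congrArg (fun f : E →L[ℝ] ℝ => f u) h1
  refine h2.trans ?_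
  have h3 : fderiv ℝ A y u = A y ∘L chr G y u - chr G y u ∘L A y := by
    ext v
    have := congrArg (fun f : E →L[ℝ] E →L[ℝ] E => f u v) hN
    simp [covEndo_apply] at this
    simp only [sub_apply, ContinuousLinearMap.comp_apply]
    rw [← sub_eq_zero, ← this]
    abel
  have h4 : traceL (A y ∘L A y ∘L chr G y u) = traceL ((A y ∘L chr G y u) ∘L A y) := by
    rw [traceL_comp_comm (A y ∘L chr G y u)]
  have h5 : traceL (A y ∘L chr G y u ∘L A y) = traceL ((chr G y u ∘L A y) ∘L A y) := by
    rw [traceL_comp_comm (A y)]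
  have h6 := traceL_comp_comm (A y) (chr G y u)
  simp [h3, ContinuousLinearMap.comp_sub, ContinuousLinearMap.sub_comp, h4, h5, h6]
  simp only [ContinuousLinearMap.comp_assoc] at *
  linarith

include hG hA hy in
-- For a `G`-symmetric `F`, the trace of `F²` is the sum of the squared norms of the `F e_i`.
theorem eq_smul_of_traceL_sq_eq_zero (C : ℝ)
    (h : traceL ((A y - C • ContinuousLinearMap.id ℝ E) ∘L
      (A y - C • ContinuousLinearMap.id ℝ E)) = 0) (v : E) : A y v = C • v := by
  have hI := hG.isInner y hy
  obtain ⟨e, he⟩ := hI.exists_orthonormalBasis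
  set F := A y - C • ContinuousLinearMap.id ℝ E with hF
  have hs : ∀ u v, G y (F u) v = G y u (F v) := by
    intro u v
    simp [hF, hA.symm y hy]
  rw [traceL_eq_sum he] at h
  simp only [ContinuousLinearMap.comp_apply, hs (F _)] at h
  rw [Finset.sum_eq_zero_iff_of_nonneg fun i _ => hI.nonneg _] at h
  have h1 : (F : E →ₗ[ℝ] E) = 0 := e.ext fun i => by
    simpa using hI.eq_zero (h i (Finset.mem_univ i))
  have h2 : F v = 0 := congrArg (fun f : E →ₗ[ℝ] E => f v) h1
  simpa [hF, sub_eq_zero] using h2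

end Vanishing

/-! ### The derivative of the determinant along a congruence. -/

section DetDerivative

variable {ι : Type*} [Fintype ι] [DecidableEq ι]

theorem contDiff_det : ContDiff ℝ ∞ (fun m : ι → ι → ℝ => (Matrix.of m).det) := by
  simp only [Matrix.det_apply, Matrix.of_apply]
  fun_prop

/-- The direction is the velocity at `0` of `(1 + tT)ᵀ M (1 + tT)`, whose determinant is `det(1 +
tT)² det M`. By metric compatibility a Gram matrix varies in exactly such a direction, with `T` the
matrix of `Γ_v`. -/
theorem fderiv_det_symm (M T : Matrix ι ι ℝ) :
    fderiv ℝ (fun m : ι → ι → ℝ => (Matrix.of m).det) (fun i j => M i j)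
      (fun i j => (T.transpose * M + M * T) i j) = 2 * T.trace * M.det := by
  set c : ℝ → ι → ι → ℝ := fun t i j =>
    M i j + t * (T.transpose * M + M * T) i j + t ^ 2 * (T.transpose * M * T) i j with hc
  have hd : HasDerivAt c (fun i j => (T.transpose * M + M * T) i j) 0 := by
    rw [hasDerivAt_pi]
    intro i
    rw [hasDerivAt_pi]
    intro j
    have h := (((hasDerivAt_id (0 : ℝ)).mul_const ((T.transpose * M + M * T) i j)).const_add
      (M i j)).add (((hasDerivAt_id (0 : ℝ)).pow 2).mul_const ((T.transpose * M * T) i j))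
    refine HasDerivAt.congr_deriv (f := fun t : ℝ => c t i j) h ?_
    norm_num
  have h0 : c 0 = fun i j => M i j := by simp [hc]
  have h1 := (h0 ▸ (contDiff_det (ι := ι)).differentiable (by simp) (c 0) :
    DifferentiableAt ℝ (fun m : ι → ι → ℝ => (Matrix.of m).det) (c 0)).hasFDerivAt.comp_hasDerivAt
      (0 : ℝ) hd
  have h2 : ((fun m : ι → ι → ℝ => (Matrix.of m).det) ∘ c)
      = fun t => ((1 + t • T).det) ^ 2 * M.det := by
    funext t
    have : Matrix.of (c t) = (1 + t • T).transpose * M * (1 + t • T) := by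
      ext i j
      simp only [hc, Matrix.of_apply, Matrix.transpose_add, Matrix.transpose_one,
        Matrix.transpose_smul, add_mul, mul_add, one_mul, mul_one, Matrix.add_apply,
        Matrix.smul_mul, Matrix.mul_smul, Matrix.smul_apply, smul_eq_mul]
      ring
    simp only [Function.comp_apply, this, Matrix.det_mul, Matrix.det_transpose]
    ring
  obtain ⟨q, hq⟩ : ∃ q : Polynomial ℝ, ∀ t : ℝ, (1 + t • T).det = 1 + T.trace * t
      + q.eval t * t ^ 2 := ⟨_, fun t => Matrix.det_one_add_smul t T⟩
  have h3 : HasDerivAt (fun t : ℝ => ((1 + t • T).det) ^ 2 * M.det) (2 * T.trace * M.det) 0 := by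
    have hf : (fun t : ℝ => ((1 + t • T).det) ^ 2 * M.det)
        = fun t => (1 + T.trace * t + q.eval t * t ^ 2) ^ 2 * M.det := funext fun t => by rw [hq]
    rw [hf]
    have h := (((((hasDerivAt_id (0 : ℝ)).const_mul T.trace).const_add 1).add
      ((q.hasDerivAt 0).mul ((hasDerivAt_id (0 : ℝ)).pow 2))).pow 2).mul_const M.det
    refine HasDerivAt.congr_deriv (f := fun t : ℝ =>
      (1 + T.trace * t + q.eval t * t ^ 2) ^ 2 * M.det) h ?_
    simp only [Pi.add_apply, Pi.mul_apply, Pi.pow_apply, id]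
    norm_num
  rw [h2, h0] at h1
  exact h1.unique h3

end DetDerivative

/-! ### The Riemannian density and the divergence theorem on a vector space. -/

section Density

open Filter Topology MeasureTheory

variable {ι : Type*} {E : Type*} [NormedAddCommGroup E] [NormedSpace ℝ E]
  (b : Module.Basis ι ℝ E)

/-- The Gram matrix of a bilinear form. -/
def gram (B : E →L[ℝ] E →L[ℝ] ℝ) : Matrix ι ι ℝ := Matrix.of fun i j => B (b i) (b j)

theorem gram_apply (B : E →L[ℝ] E →L[ℝ] ℝ) (i j : ι) : gram b B i j = B (b i) (b j) := rfl

variable [Fintype ι] [DecidableEq ι]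

theorem IsInner.det_gram_pos {B : E →L[ℝ] E →L[ℝ] ℝ} (hB : IsInner B) : 0 < (gram b B).det := by
  have : (gram b B).PosDef := by
    refine Matrix.PosDef.of_dotProduct_mulVec_pos ?_ ?_
    · ext i j
      simp [gram_apply, hB.symm (b j)]
    · intro x hx
      have hne : ∑ i, x i • b i ≠ 0 := by
        intro h0
        exact hx (funext fun i => Fintype.linearIndependent_iff.1 b.linearIndependent x h0 i)
      have := hB.pos _ hne
      simp only [map_sum, map_smul, sum_apply, smul_apply, smul_eq_mul] at this
      simp only [dotProduct, Matrix.mulVec, gram_apply, star_trivial]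
      refine this.trans_eq ?_
      refine Finset.sum_congr rfl fun i _ => ?_
      rw [Finset.mul_sum, Finset.mul_sum]
      refine Finset.sum_congr rfl fun j _ => ?_
      rw [hB.symm]; ring
  exact this.det_pos

/-- The density of the Riemannian volume. -/
def dens (G : E → E →L[ℝ] E →L[ℝ] ℝ) (y : E) : ℝ := √(gram b (G y)).det

theorem gram_eq_of_basis (B B' : E →L[ℝ] E →L[ℝ] ℝ) (L : E →L[ℝ] E)
    (h : ∀ u v, B u v = B' u (L v)) :
    gram b B = gram b B' * LinearMap.toMatrix b b (L : E →ₗ[ℝ] E) := by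
  ext i j
  rw [gram_apply, h, Matrix.mul_apply]
  conv_lhs => rw [← b.sum_repr (L (b j))]
  simp only [map_sum, map_smul, smul_eq_mul, gram_apply, LinearMap.toMatrix_apply, mul_comm,
    ContinuousLinearMap.coe_coe]

theorem gram_eq_of_basis_left (B B' : E →L[ℝ] E →L[ℝ] ℝ) (L : E →L[ℝ] E)
    (h : ∀ u v, B u v = B' (L u) v) :
    gram b B = (LinearMap.toMatrix b b (L : E →ₗ[ℝ] E)).transpose * gram b B' := by
  have := gram_eq_of_basis b B.flip B'.flip L fun u v => by simp [h]
  have h2 := congrArg Matrix.transpose this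
  rw [Matrix.transpose_mul] at h2
  exact h2

variable {G G' : E → E →L[ℝ] E →L[ℝ] ℝ} {U U' : Set E} {y : E}

theorem IsMetricOn.dens_pos (hG : IsMetricOn G U) (hy : y ∈ U) : 0 < dens b G y :=
  Real.sqrt_pos.2 ((hG.isInner y hy).det_gram_pos b)

theorem IsMetricOn.contDiffOn_det (hG : IsMetricOn G U) :
    ContDiffOn ℝ ∞ (fun y => (gram b (G y)).det) U := by
  have : ContDiffOn ℝ ∞ (fun y => fun i j => G y (b i) (b j)) U := by
    rw [contDiffOn_pi]
    intro i
    rw [contDiffOn_pi]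
    intro j
    exact (hG.smooth.clm_apply contDiffOn_const).clm_apply contDiffOn_const
  exact contDiff_det.comp_contDiffOn this

theorem IsMetricOn.contDiffOn_dens (hG : IsMetricOn G U) : ContDiffOn ℝ ∞ (dens b G) U :=
  (hG.contDiffOn_det b).sqrt fun _ hy => ((hG.isInner _ hy).det_gram_pos b).ne'

theorem IsIsometryAt.dens_eq {Ψ : E → E} (hΨ : IsIsometryAt G G' Ψ y) :
    dens b G y = |(fderiv ℝ Ψ y).det| * dens b G' (Ψ y) := by
  set L := fderiv ℝ Ψ y
  have e1 := gram_eq_of_basis b (G y)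
    ((G' (Ψ y)) ∘L L) L fun u v => by simp [hΨ.pullback.self_of_nhds, L]
  have e2 := gram_eq_of_basis_left b ((G' (Ψ y)) ∘L L) (G' (Ψ y)) L fun u v => by simp
  have h : (gram b (G y)).det = L.det ^ 2 * (gram b (G' (Ψ y))).det := by
    rw [e1, e2, Matrix.det_mul, Matrix.det_mul, Matrix.det_transpose, LinearMap.det_toMatrix]
    change _ = (LinearMap.det (L : E →ₗ[ℝ] E)) ^ 2 * _
    ring
  rw [dens, h, Real.sqrt_mul (sq_nonneg _), Real.sqrt_sq_eq_abs, dens]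

variable [FiniteDimensional ℝ E]

theorem traceL_eq_matrix_trace (F : E →L[ℝ] E) :
    traceL F = (LinearMap.toMatrix b b (F : E →ₗ[ℝ] E)).trace := by
  rw [traceL_apply, LinearMap.trace_eq_matrix_trace ℝ b]

theorem IsMetricOn.fderiv_dens (hG : IsMetricOn G U) (hy : y ∈ U) (v : E) :
    fderiv ℝ (dens b G) y v = dens b G y * traceL (chr G y v) := by
  have hpos := (hG.isInner y hy).det_gram_pos b
  have hdet : fderiv ℝ (fun y => (gram b (G y)).det) y v
      = 2 * traceL (chr G y v) * (gram b (G y)).det := by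
    have h1 : HasFDerivAt (fun y => fun i j => G y (b i) (b j))
        (ContinuousLinearMap.pi fun i => ContinuousLinearMap.pi fun j =>
          fderiv ℝ (fun z => G z (b i) (b j)) y) y := by
      rw [hasFDerivAt_pi]
      intro i
      rw [hasFDerivAt_pi]
      intro j
      have dG := hG.differentiableAt hy
      exact ((dG.clm_apply (differentiableAt_const _)).clm_apply
        (differentiableAt_const _)).hasFDerivAt
    have h2 := (contDiff_det (ι := ι).differentiable (by simp)
      (fun i j => G y (b i) (b j))).hasFDerivAt.comp y h1
    have h3 := congrArg (fun f : E →L[ℝ] ℝ => f v) h2.fderiv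
    refine h3.trans ?_
    rw [traceL_eq_matrix_trace b, ← fderiv_det_symm]
    simp only [ContinuousLinearMap.comp_apply]
    congr 1
    funext i j
    simp only [ContinuousLinearMap.pi_apply]
    rw [fderiv_apply_const₂ (hG.differentiableAt hy), hG.fderiv_eq hy]
    have e1 := gram_eq_of_basis b ((ContinuousLinearMap.compL ℝ E E ℝ).flip (chr G y v) ∘L G y)
      (G y) (chr G y v) fun u v => by simp
    have e2 := gram_eq_of_basis_left b (G y ∘L chr G y v) (G y) (chr G y v) fun u v => by simp
    rw [Matrix.add_apply, ← e1, ← e2]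
    simp [gram_apply]
  have h4 : DifferentiableAt ℝ (fun y => (gram b (G y)).det) y :=
    ((hG.contDiffOn_det b).contDiffAt (hG.mem_nhds hy)).differentiableAt (by simp)
  have h5 := congrArg (fun f : E →L[ℝ] ℝ => f v) (h4.hasFDerivAt.sqrt hpos.ne').fderiv
  refine h5.trans ?_
  simp only [smul_apply, smul_eq_mul, hdet, dens]
  have h6 := Real.sq_sqrt hpos.le
  have h7 := Real.sqrt_pos.2 hpos
  field_simp
  rw [h6, mul_comm]

/-- The classical `∂_i(√g X^i) = √g div X`: the density has derivative `√g tr Γ_v`, and symmetry of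
`Γ` identifies `tr Γ_X` with the trace of `u ↦ Γ(u, X)`. -/
theorem IsMetricOn.traceL_fderiv_dens_smul (hG : IsMetricOn G U) (hy : y ∈ U) {X : E → E}
    (hX : DifferentiableAt ℝ X y) :
    traceL (fderiv ℝ (fun z => dens b G z • X z) y)
      = dens b G y * traceL (covVec (chr G) X y) := by
  have hd : DifferentiableAt ℝ (dens b G) y :=
    ((hG.contDiffOn_dens b).contDiffAt (hG.mem_nhds hy)).differentiableAt (by simp)
  have h1 := (hd.hasFDerivAt.smul hX.hasFDerivAt).fderiv
  have h2 : (chr G y).flip (X y) = chr G y (X y) := by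
    ext u; simp [hG.chr_symm hy u]
  have h3 : fderiv ℝ (fun z => dens b G z • X z) y = _ := h1
  rw [h3, map_add, map_smul, traceL_smulRight, hG.fderiv_dens b hy, covVec, map_add, h2]
  simp only [smul_eq_mul]
  ring

theorem integral_traceL_fderiv_eq_zero [MeasurableSpace E] [BorelSpace E] (ν : Measure E)
    [ν.IsAddHaarMeasure] {Y : E → E} (hY : ContDiff ℝ 1 Y) (hs : HasCompactSupport Y) :
    ∫ y, traceL (fderiv ℝ Y y) ∂ν = 0 := by
  let b := Module.finBasis ℝ E
  have h1 : ∀ y, traceL (fderiv ℝ Y y)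
      = ∑ i, fderiv ℝ (fun z => (b.coord i).toContinuousLinearMap (Y z)) y (b i) := by
    intro y
    rw [traceL_eq_matrix_trace b, Matrix.trace]
    refine Finset.sum_congr rfl fun i _ => ?_
    have := ((b.coord i).toContinuousLinearMap.hasFDerivAt.comp y
      (hY.differentiable (by simp) y).hasFDerivAt).fderiv
    have h2 : fderiv ℝ (fun z => (b.coord i).toContinuousLinearMap (Y z)) y = _ := this
    rw [h2]
    simp [LinearMap.toMatrix_apply]
  have h3 : ∀ i, ContDiff ℝ 1 (fun z => (b.coord i).toContinuousLinearMap (Y z)) := fun i =>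
    (b.coord i).toContinuousLinearMap.contDiff.comp hY
  have h4 : ∀ i, HasCompactSupport (fun z => (b.coord i).toContinuousLinearMap (Y z)) := fun i =>
    hs.comp_left (map_zero _)
  have h5 : ∀ i, Integrable (fun y =>
      fderiv ℝ (fun z => (b.coord i).toContinuousLinearMap (Y z)) y (b i)) ν := fun i =>
    (((h3 i).continuous_fderiv (by simp)).clm_apply
      continuous_const).integrable_of_hasCompactSupport ((h4 i).fderiv_apply (𝕜 := ℝ) (b i))
  simp only [h1]
  rw [integral_finsetSum _ fun i _ => h5 i]
  refine Finset.sum_eq_zero fun i _ => ?_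
  -- Integration by parts against the constant function `1`.
  have h6 := integral_mul_fderiv_eq_neg_fderiv_mul_of_integrable (𝕜 := ℝ) (μ := ν)
    (f := fun _ : E => (1 : ℝ)) (g := fun z => (b.coord i).toContinuousLinearMap (Y z)) (v := b i)
    (by simp) (by simpa using h5 i)
    (by simpa using (h3 i).continuous.integrable_of_hasCompactSupport (h4 i))
    (fun _ _ => differentiableAt_const _) (fun x _ => (h3 i).differentiable (by simp) x)
  simpa using h6

end Density

/-! ### Preferred charts, changes of coordinates, and local expressions of bilinear forms. -/

section Charts

open Filter Topology

variable {n : ℕ} {M : Type*} [TopologicalSpace M] [ChartedSpace (EuclideanSpace ℝ (Fin n)) M]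

/-- The coordinate model `ℝⁿ`. -/
abbrev Coord (n : ℕ) := EuclideanSpace ℝ (Fin n)

/-- The domain of coordinates of the preferred chart at `c`. -/
def dom (c : M) : Set (Coord n) := (extChartAt (𝓡 n) c).target

/-- The point with coordinates `y` in the preferred chart at `c`. -/
def pt (c : M) (y : Coord n) : M := (extChartAt (𝓡 n) c).symm y

/-- The change of coordinates from the chart at `c` to the chart at `c'`. -/
def trans (c c' : M) (y : Coord n) : Coord n := extChartAt (𝓡 n) c' (pt c y)

/-- The derivative of the inverse of the preferred chart at `c`. -/
def dpt (c : M) (y : Coord n) : Coord n →L[ℝ] Coord n :=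
  mfderiv 𝓘(ℝ, Coord n) (𝓡 n) (extChartAt (𝓡 n) c).symm y

theorem isOpen_dom (c : M) : IsOpen (dom c : Set (Coord n)) := isOpen_extChartAt_target c

theorem pt_mem {c : M} {y : Coord n} (hy : y ∈ dom c) : pt c y ∈ (extChartAt (𝓡 n) c).source :=
  (extChartAt (𝓡 n) c).map_target hy

theorem center_mem (c : M) : extChartAt (𝓡 n) c c ∈ (dom c : Set (Coord n)) :=
  mem_extChartAt_target c

theorem pt_center (c : M) : pt c (extChartAt (𝓡 n) c c) = c := extChartAt_to_inv c

theorem pt_extChartAt {c p : M} (hp : p ∈ (extChartAt (𝓡 n) c).source) :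
    pt c (extChartAt (𝓡 n) c p) = p := (extChartAt (𝓡 n) c).left_inv hp

theorem extChartAt_mem_dom {c p : M} (hp : p ∈ (extChartAt (𝓡 n) c).source) :
    extChartAt (𝓡 n) c p ∈ (dom c : Set (Coord n)) := (extChartAt (𝓡 n) c).map_source hp

theorem extChartAt_pt {c : M} {y : Coord n} (hy : y ∈ dom c) : extChartAt (𝓡 n) c (pt c y) = y :=
  (extChartAt (𝓡 n) c).right_inv hy

theorem continuousOn_pt (c : M) : ContinuousOn (pt c) (dom c : Set (Coord n)) :=
  continuousOn_extChartAt_symm c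

theorem trans_mem {c c' : M} {y : Coord n} (hy' : pt c y ∈ (extChartAt (𝓡 n) c').source) :
    trans c c' y ∈ dom c' := (extChartAt (𝓡 n) c').map_source hy'

theorem pt_trans {c c' : M} {y : Coord n} (hy' : pt c y ∈ (extChartAt (𝓡 n) c').source) :
    pt c' (trans c c' y) = pt c y := (extChartAt (𝓡 n) c').left_inv hy'

theorem eventually_pt_mem {c : M} {y : Coord n} (hy : y ∈ dom c) {V : Set M} (hV : IsOpen V)
    (hyV : pt c y ∈ V) : ∀ᶠ z in 𝓝 y, z ∈ dom c ∧ pt c z ∈ V := by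
  have h1 := (isOpen_dom c).mem_nhds hy
  filter_upwards [h1, ((continuousOn_pt c).continuousAt h1).preimage_mem_nhds (hV.mem_nhds hyV)]
    with z hz hz' using ⟨hz, hz'⟩

/-- A bilinear form on `T_p M`, as a form on the model space. -/
def modelForm (B : (p : M) → TangentSpace (𝓡 n) p →L[ℝ] TangentSpace (𝓡 n) p →L[ℝ] ℝ) (p : M) :
    Coord n →L[ℝ] Coord n →L[ℝ] ℝ := B p

/-- The expression of a field of bilinear forms in the preferred chart at `c`. -/
def localForm (B : (p : M) → TangentSpace (𝓡 n) p →L[ℝ] TangentSpace (𝓡 n) p →L[ℝ] ℝ) (c : M)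
    (y : Coord n) : Coord n →L[ℝ] Coord n →L[ℝ] ℝ :=
  (ContinuousLinearMap.compL ℝ (Coord n) (Coord n) ℝ).flip (dpt c y) ∘L
    modelForm B (pt c y) ∘L dpt c y

theorem localForm_apply (B : (p : M) → TangentSpace (𝓡 n) p →L[ℝ] TangentSpace (𝓡 n) p →L[ℝ] ℝ)
    (c : M) (y u v : Coord n) :
    localForm B c y u v = modelForm B (pt c y) (dpt c y u) (dpt c y v) := rfl

section Smooth

variable [IsManifold (𝓡 n) ∞ M]

theorem contMDiffOn_pt (c : M) : ContMDiffOn 𝓘(ℝ, Coord n) (𝓡 n) ∞ (pt c : Coord n → M) (dom c) :=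
  contMDiffOn_extChartAt_symm c

theorem contDiffAt_trans {c c' : M} {y : Coord n} (hy : y ∈ dom c)
    (hy' : pt c y ∈ (extChartAt (𝓡 n) c').source) : ContDiffAt ℝ ∞ (trans c c') y := by
  rw [← contMDiffAt_iff_contDiffAt]
  have h1 : ContMDiffAt (𝓡 n) 𝓘(ℝ, Coord n) ∞ (extChartAt (𝓡 n) c') (pt c y) :=
    contMDiffAt_extChartAt' (by simpa using hy')
  exact h1.comp y ((contMDiffOn_pt c).contMDiffAt ((isOpen_dom c).mem_nhds hy))

theorem dpt_comp_fderiv_trans {c c' : M} {y : Coord n} (hy : y ∈ dom c)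
    (hy' : pt c y ∈ (extChartAt (𝓡 n) c').source) (u : Coord n) :
    dpt c' (trans c c' y) (fderiv ℝ (trans c c') y u) = dpt c y u := by
  have hΨ : MDifferentiableAt 𝓘(ℝ, Coord n) 𝓘(ℝ, Coord n) (trans c c') y :=
    ((contDiffAt_trans hy hy').differentiableAt (by simp)).mdifferentiableAt
  have hp : MDifferentiableAt 𝓘(ℝ, Coord n) (𝓡 n) (pt c') (trans c c' y) :=
    ((contMDiffOn_pt c').contMDiffAt ((isOpen_dom c').mem_nhds (trans_mem hy'))).mdifferentiableAt
      (by simp)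
  have h1 := mfderiv_comp y hp hΨ
  have h2 : pt c' ∘ trans c c' =ᶠ[𝓝 y] pt c := by
    filter_upwards [eventually_pt_mem hy (isOpen_extChartAt_source c') hy'] with z hz
      using pt_trans hz.2
  rw [h2.mfderiv_eq, mfderiv_eq_fderiv] at h1
  exact (congrArg (fun f : Coord n →L[ℝ] Coord n => f u) h1).symm

/-- A tangent vector at `c` is identified with its coordinates in the preferred chart at `c`; away
from the centre `dpt` need not be the identity. -/
theorem dpt_center (c : M) (u : Coord n) : dpt c (extChartAt (𝓡 n) c c) u = u := by
  have h := mfderivWithin_range_extChartAt_symm (I := 𝓡 n) (x := c)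
  rw [ModelWithCorners.range_eq_univ, mfderivWithin_univ] at h
  unfold dpt
  rw [h]
  rfl

theorem dpt_injective {c : M} {y : Coord n} (hy : y ∈ dom c) : Function.Injective (dpt c y) := by
  intro u v huv
  have hs : pt c y ∈ (extChartAt (𝓡 n) c).source := pt_mem hy
  have h1 : mfderiv (𝓡 n) 𝓘(ℝ, Coord n) (extChartAt (𝓡 n) c) (pt c y) ∘L dpt c y
      = ContinuousLinearMap.id ℝ (Coord n) := by
    have e1 : MDifferentiableAt (𝓡 n) 𝓘(ℝ, Coord n) (extChartAt (𝓡 n) c) (pt c y) :=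
      (contMDiffAt_extChartAt' (n := ∞) (by simpa using hs)).mdifferentiableAt (by simp)
    have e2 : MDifferentiableAt 𝓘(ℝ, Coord n) (𝓡 n) (pt c : Coord n → M) y :=
      ((contMDiffOn_pt c).contMDiffAt ((isOpen_dom c).mem_nhds hy)).mdifferentiableAt (by simp)
    have h2 := mfderiv_comp y e1 e2
    have h3 : extChartAt (𝓡 n) c ∘ pt c =ᶠ[𝓝 y] id := by
      filter_upwards [(isOpen_dom c).mem_nhds hy] with z hz using extChartAt_pt hz
    rw [h3.mfderiv_eq, mfderiv_id] at h2
    exact h2.symm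
  have h4 := fun w => congrArg (fun f : Coord n →L[ℝ] Coord n => f w) h1
  have h5 : ∀ w : Coord n, (mfderiv (𝓡 n) 𝓘(ℝ, Coord n) (extChartAt (𝓡 n) c) (pt c y)
    : Coord n →L[ℝ] Coord n) (dpt c y w) = w := h4
  rw [← h5 u, huv, h5]

/-- A coordinate field is the image of a constant field under the tangent map of the inverse chart,
which is smooth between the tangent bundles. -/
theorem contMDiffOn_dpt (c : M) (u : Coord n) :
    ContMDiffOn 𝓘(ℝ, Coord n) (𝓡 n).tangent ∞
      (fun y => Bundle.TotalSpace.mk' (Coord n) (E := fun p : M => TangentSpace (𝓡 n) p)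
        (pt c y) (dpt c y u)) (dom c) := by
  have h1 := (contMDiffOn_pt (n := n) c).contMDiffOn_tangentMapWithin (m := ∞) (by simp)
    (isOpen_dom c).uniqueMDiffOn
  have h2 : ContMDiff 𝓘(ℝ, Coord n) 𝓘(ℝ, Coord n).tangent ∞
      (fun y : Coord n => (⟨y, u⟩ : TangentBundle 𝓘(ℝ, Coord n) (Coord n))) := by
    rw [contMDiff_vectorSpace_iff_contDiff (V := fun _ : Coord n => u)]
    exact contDiff_const
  have h3 := h1.comp (t := Bundle.TotalSpace.proj ⁻¹' (dom c)) (s := dom c) h2.contMDiffOn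
    (fun y hy => hy)
  refine h3.congr fun y hy => ?_
  simp only [Function.comp_apply, tangentMapWithin]
  rw [mfderivWithin_of_isOpen (isOpen_dom c) hy]
  rfl

theorem localForm_trans (B : (p : M) → TangentSpace (𝓡 n) p →L[ℝ] TangentSpace (𝓡 n) p →L[ℝ] ℝ)
    {c c' : M} {y : Coord n} (hy : y ∈ dom c) (hy' : pt c y ∈ (extChartAt (𝓡 n) c').source)
    (u v : Coord n) : localForm B c y u v = localForm B c' (trans c c' y)
      (fderiv ℝ (trans c c') y u) (fderiv ℝ (trans c c') y v) := by
  rw [localForm_apply, localForm_apply, dpt_comp_fderiv_trans hy hy', dpt_comp_fderiv_trans hy hy',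
    pt_trans hy']

theorem localForm_center (B : (p : M) → TangentSpace (𝓡 n) p →L[ℝ] TangentSpace (𝓡 n) p →L[ℝ] ℝ)
    (c : M) : localForm B c (extChartAt (𝓡 n) c c) = modelForm B c := by
  ext u v : 2
  rw [localForm_apply, dpt_center, dpt_center, pt_center]

theorem contDiffOn_localForm
    {B : (p : M) → TangentSpace (𝓡 n) p →L[ℝ] TangentSpace (𝓡 n) p →L[ℝ] ℝ}
    (hB : ContMDiff (𝓡 n) ((𝓡 n).prod 𝓘(ℝ, Coord n →L[ℝ] Coord n →L[ℝ] ℝ)) ∞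
      (fun x => Bundle.TotalSpace.mk' (Coord n →L[ℝ] Coord n →L[ℝ] ℝ)
        (E := fun x : M => TangentSpace (𝓡 n) x →L[ℝ] TangentSpace (𝓡 n) x →L[ℝ] ℝ) x (B x)))
    (c : M) : ContDiffOn ℝ ∞ (localForm B c) (dom c) := by
  rw [contDiffOn_clm_apply]
  intro u
  rw [contDiffOn_clm_apply]
  intro v
  rw [← contMDiffOn_iff_contDiffOn]
  have h1 : ContMDiffOn 𝓘(ℝ, Coord n) ((𝓡 n).prod 𝓘(ℝ, ℝ)) ∞
      (fun y ↦ Bundle.TotalSpace.mk' ℝ (E := Bundle.Trivial M ℝ) (pt c y)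
        (B (pt c y) (dpt c y u) (dpt c y v))) (dom c) := by
    apply ContMDiffOn.clm_bundle_apply₂ (F₁ := Coord n) (F₂ := Coord n)
      (E₁ := fun p : M => TangentSpace (𝓡 n) p) (E₂ := fun p : M => TangentSpace (𝓡 n) p)
    · exact hB.comp_contMDiffOn (contMDiffOn_pt c)
    · exact contMDiffOn_dpt c u
    · exact contMDiffOn_dpt c v
  intro y hy
  have h2 := h1 y hy
  simp only [Bundle.contMDiffWithinAt_totalSpace] at h2
  exact h2.2

end Smooth

end Charts

/-! ### The divergence theorem on a closed manifold. -/

section DivergenceTheorem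

open Filter Topology MeasureTheory

variable {n : ℕ} {M : Type*} [TopologicalSpace M] [ChartedSpace (EuclideanSpace ℝ (Fin n)) M]
  [IsManifold (𝓡 n) ∞ M] (g : Metric n M)

/-- The metric in the preferred chart at `c`. -/
def locMetric (c : M) (y : Coord n) : Coord n →L[ℝ] Coord n →L[ℝ] ℝ := localForm g.inner c y

theorem isInner_modelForm (p : M) : IsInner (modelForm g.inner p) :=
  ⟨g.symm p, g.pos p⟩

theorem isMetricOn_locMetric (c : M) : IsMetricOn (locMetric g c) (dom c) where
  isOpen := isOpen_dom c
  smooth := contDiffOn_localForm g.contMDiff c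
  isInner y hy :=
    { symm := fun _ _ => (isInner_modelForm g _).symm _ _
      pos := fun u hu => (isInner_modelForm g _).pos _ fun h =>
        hu (dpt_injective hy ((show dpt c y u = 0 from h).trans (map_zero _).symm)) }

theorem isIsometryAt_trans {c c' : M} {y : Coord n} (hy : y ∈ dom c)
    (hy' : pt c y ∈ (extChartAt (𝓡 n) c').source) :
    IsIsometryAt (locMetric g c) (locMetric g c') (trans c c') y where
  smooth := contDiffAt_trans hy hy'
  pullback := by
    filter_upwards [eventually_pt_mem hy (isOpen_extChartAt_source c') hy'] with z hz u v
      using localForm_trans g.inner hz.1 hz.2 u v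

theorem contDiffOn_comp_pt {f : M → ℝ} (hf : ContMDiff (𝓡 n) 𝓘(ℝ, ℝ) ∞ f) (c : M) :
    ContDiffOn ℝ ∞ (fun y => f (pt c y)) (dom c : Set (Coord n)) := by
  rw [← contMDiffOn_iff_contDiffOn]
  exact hf.comp_contMDiffOn (contMDiffOn_pt c)

/-- A smooth vector field, given by its expressions in the preferred charts. -/
structure IsVecField (X : M → Coord n → Coord n) : Prop where
  smooth : ∀ c, ContDiffOn ℝ ∞ (X c) (dom c)
  natural : ∀ (c c' : M) (y : Coord n), y ∈ dom c → pt c y ∈ (extChartAt (𝓡 n) c').source →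
    fderiv ℝ (trans c c') y (X c y) = X c' (trans c c' y)

/-- The divergence of a vector field. -/
def vecDiv (X : M → Coord n → Coord n) (p : M) : ℝ :=
  traceL (covVec (chr (locMetric g p)) (X p) (extChartAt (𝓡 n) p p))

section
variable {g} {X : M → Coord n → Coord n} (hX : IsVecField X)
include hX

omit [IsManifold (𝓡 n) ∞ M] in
theorem IsVecField.differentiableAt {c : M} {y : Coord n} (hy : y ∈ dom c) :
    DifferentiableAt ℝ (X c) y :=
  ((hX.smooth c).contDiffAt ((isOpen_dom c).mem_nhds hy)).differentiableAt (by simp)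

/-- `vecDiv` is read at `p` in the chart centred at `p`, which changes with `p`. Naturality replaces
it by one fixed chart, where continuity and integrals can be handled. -/
theorem traceL_covVec_eq_vecDiv {c : M} {y : Coord n} (hy : y ∈ dom c) :
    traceL (covVec (chr (locMetric g c)) (X c) y) = vecDiv g X (pt c y) := by
  have hy' : pt c y ∈ (extChartAt (𝓡 n) (pt c y)).source := mem_extChartAt_source _
  refine (isIsometryAt_trans g hy hy').traceL_covVec (isMetricOn_locMetric g c) hy
    (isMetricOn_locMetric g (pt c y)) (trans_mem hy') (hX.differentiableAt hy)
    (hX.differentiableAt (trans_mem hy')) ?_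
  filter_upwards [eventually_pt_mem hy (isOpen_extChartAt_source _) hy'] with z hz
    using hX.natural _ _ _ hz.1 hz.2

theorem IsVecField.smul {f : M → ℝ} (hf : ContMDiff (𝓡 n) 𝓘(ℝ, ℝ) ∞ f) :
    IsVecField fun c y => f (pt c y) • X c y where
  smooth c := (contDiffOn_comp_pt hf c).smul (hX.smooth c)
  natural c c' y hy hy' := by
    rw [map_smul, hX.natural c c' y hy hy', pt_trans hy']

theorem continuousOn_vecDiv (c : M) :
    ContinuousOn (fun y => vecDiv g X (pt c y)) (dom c : Set (Coord n)) := by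
  have hG := isMetricOn_locMetric g c
  have h1 : ContinuousOn (fderiv ℝ (X c)) (dom c) :=
    (hX.smooth c).continuousOn_fderiv_of_isOpen (isOpen_dom c) (by simp)
  have h2 : ContinuousOn (fun y => covVec (chr (locMetric g c)) (X c) y) (dom c) := by
    refine h1.add ?_
    have h3 := hG.contDiffOn_chr.continuousOn
    have h4 := (ContinuousLinearMap.flipₗᵢ ℝ (Coord n) (Coord n) (Coord n)
      ).continuous.comp_continuousOn h3
    exact h4.clm_apply (hX.smooth c).continuousOn
  refine ((traceL (E := Coord n)).continuous.comp_continuousOn h2).congr fun y hy => ?_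
  rw [← traceL_covVec_eq_vecDiv hX hy]
  rfl

end

/-- The Riemannian density in the preferred chart at `c`. -/
def volDens (c : M) (y : Coord n) : ℝ :=
  dens (EuclideanSpace.basisFun (Fin n) ℝ).toBasis (locMetric g c) y

theorem volDens_pos {c : M} {y : Coord n} (hy : y ∈ dom c) : 0 < volDens g c y :=
  (isMetricOn_locMetric g c).dens_pos _ hy

theorem contDiffOn_volDens (c : M) : ContDiffOn ℝ ∞ (volDens g c) (dom c) :=
  (isMetricOn_locMetric g c).contDiffOn_dens _

/-- The integral over the domain of the preferred chart at `c`. -/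
def chartIntegral (c : M) (f : M → ℝ) : ℝ :=
  ∫ y in (dom c : Set (Coord n)), f (pt c y) * volDens g c y

/-- The two vanishing conditions confine both integrals to the overlap of the charts; there the
Jacobian of the change of variables is absorbed by the density. -/
theorem chartIntegral_eq_of_support {c c' : M} {f : M → ℝ}
    (hc : ∀ p, p ∉ (extChartAt (𝓡 n) c).source → f p = 0)
    (hc' : ∀ p, p ∉ (extChartAt (𝓡 n) c').source → f p = 0) :
    chartIntegral g c f = chartIntegral g c' f := by
  have hs : ∀ c c' : M, IsOpen {y : Coord n | y ∈ dom c ∧ pt c y ∈ (extChartAt (𝓡 n) c').source} :=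
    fun c c' => (continuousOn_pt c).isOpen_inter_preimage (isOpen_dom c)
      (isOpen_extChartAt_source c')
  have h1 : ∀ c c' : M, (∀ p, p ∉ (extChartAt (𝓡 n) c').source → f p = 0) →
      chartIntegral g c f =
        ∫ y in {y : Coord n | y ∈ dom c ∧ pt c y ∈ (extChartAt (𝓡 n) c').source},
          f (pt c y) * volDens g c y := by
    intro c c' hc'
    refine setIntegral_eq_of_subset_of_forall_sdiff_eq_zero (isOpen_dom c).measurableSet
      (fun y hy => hy.1) fun y hy => ?_
    rw [hc' _ fun h => hy.2 ⟨hy.1, h⟩, zero_mul]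
  rw [h1 c c' hc', h1 c' c hc]
  have himg : {y : Coord n | y ∈ dom c' ∧ pt c' y ∈ (extChartAt (𝓡 n) c).source}
      = trans c c' '' {y : Coord n | y ∈ dom c ∧ pt c y ∈ (extChartAt (𝓡 n) c').source} := by
    ext y
    constructor
    · rintro ⟨h, h'⟩
      refine ⟨trans c' c y, ⟨trans_mem h', ?_⟩, ?_⟩
      · rw [pt_trans h']; exact pt_mem h
      · rw [trans, pt_trans h', extChartAt_pt h]
    · rintro ⟨z, ⟨h, h'⟩, rfl⟩
      refine ⟨trans_mem h', ?_⟩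
      rw [pt_trans h']; exact pt_mem h
  rw [himg, integral_image_eq_integral_abs_det_fderiv_smul volume (hs c c').measurableSet
    (f' := fun y => fderiv ℝ (trans c c') y)]
  · refine setIntegral_congr_fun (hs c c').measurableSet fun y hy => ?_
    have := (isIsometryAt_trans g hy.1 hy.2).dens_eq (EuclideanSpace.basisFun (Fin n) ℝ).toBasis
    simp only [smul_eq_mul, pt_trans hy.2]
    rw [volDens, this, volDens]
    ring
  · intro y hy
    exact ((contDiffAt_trans hy.1 hy.2).differentiableAt (by simp)).hasFDerivAt.hasFDerivWithinAt
  · intro y hy z hz h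
    have : pt c y = pt c z := by rw [← pt_trans hy.2, ← pt_trans hz.2, h]
    rw [← extChartAt_pt hy.1, ← extChartAt_pt hz.1, this]

variable {X : M → Coord n → Coord n}

theorem vecDiv_sum {ι : Type*} (s : Finset ι) {ρ : ι → M → ℝ} (hX : IsVecField X)
    (hρ : ∀ i, ContMDiff (𝓡 n) 𝓘(ℝ, ℝ) ∞ (ρ i)) (h1 : ∀ p, ∑ i ∈ s, ρ i p = 1) (p : M) :
    ∑ i ∈ s, vecDiv g (fun c y => ρ i (pt c y) • X c y) p = vecDiv g X p := by
  have h2 : X p = fun y => ∑ i ∈ s, ρ i (pt p y) • X p y := by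
    funext y; rw [← Finset.sum_smul, h1, one_smul]
  have hp := center_mem (n := n) p
  have h3 : ∀ i ∈ s, HasFDerivAt (fun y => ρ i (pt p y) • X p y)
      (fderiv ℝ (fun y => ρ i (pt p y) • X p y) (extChartAt (𝓡 n) p p)) (extChartAt (𝓡 n) p p) :=
    fun i _ => ((hX.smul (hρ i)).differentiableAt hp).hasFDerivAt
  have h4 := (HasFDerivAt.fun_sum h3).fderiv
  have h5 : covVec (chr (locMetric g p)) (X p) (extChartAt (𝓡 n) p p)
      = ∑ i ∈ s, covVec (chr (locMetric g p)) (fun y => ρ i (pt p y) • X p y)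
        (extChartAt (𝓡 n) p p) := by
    ext1 u
    conv_lhs => rw [h2]
    rw [covVec_apply, h4]
    simp [covVec_apply, Finset.sum_add_distrib]
  rw [vecDiv, h5, map_sum]
  rfl

omit [IsManifold (𝓡 n) ∞ M] in
theorem coords_subset {c : M} {K : Set M} (hKc : K ⊆ (extChartAt (𝓡 n) c).source) :
    extChartAt (𝓡 n) c '' K ⊆ (dom c : Set (Coord n)) := by
  rintro _ ⟨p, hp, rfl⟩
  exact extChartAt_mem_dom (hKc hp)

variable [CompactSpace M]

omit [IsManifold (𝓡 n) ∞ M] in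
/-- The coordinates of a closed subset of the chart domain. -/
theorem isCompact_coords {c : M} {K : Set M} (hK : IsClosed K)
    (hKc : K ⊆ (extChartAt (𝓡 n) c).source) : IsCompact (extChartAt (𝓡 n) c '' K) :=
  hK.isCompact.image_of_continuousOn ((continuousOn_extChartAt c).mono hKc)

theorem integrableOn_of_support {c : M} {K : Set M} (hK : IsClosed K)
    (hKc : K ⊆ (extChartAt (𝓡 n) c).source) {f : M → ℝ}
    (hf : ContinuousOn (fun y => f (pt c y)) (dom c : Set (Coord n))) (hfK : ∀ p, p ∉ K → f p = 0) :
    IntegrableOn (fun y => f (pt c y) * volDens g c y) (dom c : Set (Coord n)) := by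
  have h1 : ContinuousOn (fun y => f (pt c y) * volDens g c y) (dom c : Set (Coord n)) :=
    hf.mul (contDiffOn_volDens g c).continuousOn
  have h2 := (h1.mono (coords_subset hKc)).integrableOn_compact (μ := volume)
    (isCompact_coords hK hKc)
  refine h2.of_forall_sdiff_eq_zero (isOpen_dom c).measurableSet fun y hy => ?_
  rw [hfK _ fun h => hy.2 ⟨_, h, extChartAt_pt hy.1⟩, zero_mul]

/-- Multiplied by the density, the field is a compactly supported field on `ℝⁿ` whose flat
divergence is the integrand. It has to be extended by zero explicitly, since `X c` is unconstrained
outside `dom c`. -/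
theorem chartIntegral_vecDiv_eq_zero (hX : IsVecField X) {c : M} {K : Set M} (hK : IsClosed K)
    (hKc : K ⊆ (extChartAt (𝓡 n) c).source)
    (hXK : ∀ y ∈ (dom c : Set (Coord n)), pt c y ∉ K → X c y = 0) :
    chartIntegral g c (vecDiv g X) = 0 := by
  classical
  set Y : Coord n → Coord n := fun y => if y ∈ (dom c : Set (Coord n)) then
    volDens g c y • X c y else 0 with hYdef
  set L := extChartAt (𝓡 n) c '' K with hL
  have hLc : IsCompact L := isCompact_coords hK hKc
  have hLd : L ⊆ dom c := coords_subset hKc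
  have hY1 : ∀ y ∈ (dom c : Set (Coord n)), Y =ᶠ[𝓝 y] fun z => volDens g c z • X c z := by
    intro y hy
    filter_upwards [(isOpen_dom c).mem_nhds hy] with z hz using by simp [hYdef, hz]
  have hY0 : ∀ y, y ∉ L → Y y = 0 := by
    intro y hy
    by_cases hyd : y ∈ (dom c : Set (Coord n))
    · have : pt c y ∉ K := fun h => hy ⟨_, h, extChartAt_pt hyd⟩
      simp [hYdef, hyd, hXK y hyd this]
    · simp [hYdef, hyd]
  have hY2 : ∀ y, y ∉ L → Y =ᶠ[𝓝 y] fun _ => 0 := by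
    intro y hy
    filter_upwards [hLc.isClosed.isOpen_compl.mem_nhds hy] with z hz using hY0 z hz
  have hYs : ContDiff ℝ 1 Y := by
    rw [contDiff_iff_contDiffAt]
    intro y
    by_cases hy : y ∈ L
    · have := (((contDiffOn_volDens g c).smul (hX.smooth c)).contDiffAt
        ((isOpen_dom c).mem_nhds (hLd hy))).of_le (m := 1) (by simp)
      exact this.congr_of_eventuallyEq (hY1 y (hLd hy))
    · exact contDiffAt_const.congr_of_eventuallyEq (hY2 y hy)
  have hYc : HasCompactSupport Y := HasCompactSupport.intro hLc hY0
  rw [← integral_traceL_fderiv_eq_zero volume hYs hYc,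
    ← setIntegral_eq_integral_of_forall_compl_eq_zero (s := (dom c : Set (Coord n)))
      (f := fun y => traceL (fderiv ℝ Y y))]
  · refine setIntegral_congr_fun (isOpen_dom c).measurableSet fun y hy => ?_
    rw [(hY1 y hy).fderiv_eq, ← traceL_covVec_eq_vecDiv hX hy, mul_comm]
    exact ((isMetricOn_locMetric g c).traceL_fderiv_dens_smul _ hy (hX.differentiableAt hy)).symm
  · intro y hy
    rw [(hY2 y fun h => hy (hLd h)).fderiv_eq]
    simp

/-- On a closed manifold, a nonnegative divergence vanishes. -/
theorem vecDiv_eq_zero_of_nonneg [T2Space M] (hX : IsVecField X) (hnn : ∀ p, 0 ≤ vecDiv g X p)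
    (p : M) :
    vecDiv g X p = 0 := by
  obtain ⟨ρ, hρ⟩ := SmoothPartitionOfUnity.exists_isSubordinate_chartAt_source (𝓡 n) M
  have hfin := ρ.locallyFinite.finite_nonempty_of_compact
  set s := hfin.toFinset with hs
  have h1 : ∀ p, ∑ i ∈ s, ρ i p = 1 := by
    intro p
    rw [← ρ.sum_eq_one (Set.mem_univ p)]
    refine (finsum_eq_sum_of_support_subset _ fun i hi => ?_).symm
    simp only [hs, Set.Finite.coe_toFinset, Set.mem_ofPred_eq]
    exact ⟨p, hi⟩
  have hsm : ∀ i, ContMDiff (𝓡 n) 𝓘(ℝ, ℝ) ∞ (ρ i) := fun i => (ρ i).contMDiff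
  have hsrc : ∀ i, tsupport (ρ i) ⊆ (extChartAt (𝓡 n) i).source := fun i => by
    simpa using hρ i
  have hz : ∀ i p, p ∉ tsupport (ρ i) → ρ i p = 0 := fun i p hp =>
    image_eq_zero_of_notMem_tsupport hp
  set d : M → M → ℝ := fun j => vecDiv g fun c y => ρ j (pt c y) • X c y with hd
  have hdX : ∀ j, IsVecField fun c y => ρ j (pt c y) • X c y := fun j => hX.smul (hsm j)
  have hdz : ∀ j p, p ∉ tsupport (ρ j) → d j p = 0 := by
    intro j p hp
    have h2 : (fun y => ρ j (pt p y) • X p y) =ᶠ[𝓝 (extChartAt (𝓡 n) p p)] fun _ => 0 := by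
      filter_upwards [eventually_pt_mem (center_mem p) (isClosed_tsupport (ρ j)).isOpen_compl
        (by rw [pt_center]; exact hp)] with z hz'
      rw [hz j _ hz'.2, zero_smul]
    have h3 : covVec (chr (locMetric g p)) (fun y => ρ j (pt p y) • X p y)
        (extChartAt (𝓡 n) p p) = 0 := by
      ext1 u
      have h0 : ρ j (pt p (extChartAt (𝓡 n) p p)) • X p (extChartAt (𝓡 n) p p) = 0 :=
        h2.self_of_nhds
      rw [covVec_apply, h2.fderiv_eq, h0]
      simp
    simp only [hd, vecDiv, h3, map_zero]
  have hdsum : ∀ p, ∑ j ∈ s, d j p = vecDiv g X p := vecDiv_sum g s hX hsm h1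
  have hρc : ∀ i c, ContinuousOn (fun y => ρ i (pt c y)) (dom c : Set (Coord n)) := fun i c =>
    (ρ i).contMDiff.continuous.comp_continuousOn (continuousOn_pt c)
  have hdc : ∀ j c, ContinuousOn (fun y => d j (pt c y)) (dom c : Set (Coord n)) := fun j c =>
    continuousOn_vecDiv (hdX j) c
  have hI : ∀ i, IntegrableOn (fun y => (ρ i (pt i y) * vecDiv g X (pt i y)) * volDens g i y)
      (dom i : Set (Coord n)) := fun i =>
    integrableOn_of_support g (isClosed_tsupport (ρ i)) (hsrc i)
      (f := fun p => ρ i p * vecDiv g X p) ((hρc i i).mul (continuousOn_vecDiv hX i))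
      fun p hp => by rw [hz i p hp, zero_mul]
  have hnn' : ∀ i, 0 ≤ chartIntegral g i fun p => ρ i p * vecDiv g X p := fun i =>
    setIntegral_nonneg (isOpen_dom i).measurableSet fun y hy =>
      mul_nonneg (mul_nonneg (ρ.nonneg i _) (hnn _)) (volDens_pos g hy).le
  -- No global measure is needed: this sum plays the role of `∫ div X`. With `div X = ∑_j div(ρ_j
  -- X)`, the function `ρ_i div(ρ_j X)` is supported in both charts, so its integral moves from
  -- chart `i` to chart `j`; summing over `i` then leaves `∫ div(ρ_j X) = 0`.
  have hsum : ∑ i ∈ s, chartIntegral g i (fun p => ρ i p * vecDiv g X p) = 0 := by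
    have e1 : ∀ i, chartIntegral g i (fun p => ρ i p * vecDiv g X p)
        = ∑ j ∈ s, chartIntegral g i (fun p => ρ i p * d j p) := by
      intro i
      simp only [chartIntegral]
      rw [← integral_finsetSum]
      · congr 1
        funext y
        rw [← hdsum, Finset.mul_sum, Finset.sum_mul]
      · intro j _
        exact integrableOn_of_support g (isClosed_tsupport (ρ i)) (hsrc i)
          (f := fun p => ρ i p * d j p) ((hρc i i).mul (hdc j i))
          fun p hp => by rw [hz i p hp, zero_mul]
    have e2 : ∀ i j, chartIntegral g i (fun p => ρ i p * d j p)
        = chartIntegral g j (fun p => ρ i p * d j p) := by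
      intro i j
      refine chartIntegral_eq_of_support g (fun p hp => ?_) fun p hp => ?_
      · rw [hz i p fun h => hp (hsrc i h), zero_mul]
      · rw [hdz j p fun h => hp (hsrc j h), mul_zero]
    have e3 : ∀ j, ∑ i ∈ s, chartIntegral g j (fun p => ρ i p * d j p)
        = chartIntegral g j (d j) := by
      intro j
      simp only [chartIntegral]
      rw [← integral_finsetSum]
      · congr 1
        funext y
        rw [← Finset.sum_mul, ← Finset.sum_mul, h1, one_mul]
      · intro i _
        exact integrableOn_of_support g (isClosed_tsupport (ρ j)) (hsrc j)
          (f := fun p => ρ i p * d j p) ((hρc i j).mul (hdc j j))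
          fun p hp => by rw [hdz j p hp, mul_zero]
    simp only [e1]
    rw [Finset.sum_comm]
    refine Finset.sum_eq_zero fun j _ => ?_
    rw [Finset.sum_congr rfl fun i _ => e2 i j, e3]
    exact chartIntegral_vecDiv_eq_zero g (hdX j) (isClosed_tsupport (ρ j)) (hsrc j)
      fun y _ hy => by rw [hz j _ hy, zero_smul]
  obtain ⟨i, his, hi⟩ : ∃ i ∈ s, ρ i p ≠ 0 := by
    by_contra! h
    have := h1 p
    rw [Finset.sum_eq_zero h] at this
    exact zero_ne_one this
  have hi0 := (Finset.sum_eq_zero_iff_of_nonneg fun i _ => hnn' i).1 hsum i his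
  have hps : p ∈ (extChartAt (𝓡 n) i).source := hsrc i (subset_tsupport _ hi)
  rw [chartIntegral, setIntegral_eq_zero_iff_of_nonneg_ae
    (ae_restrict_of_forall_mem (isOpen_dom i).measurableSet fun y hy =>
      mul_nonneg (mul_nonneg (ρ.nonneg i _) (hnn _)) (volDens_pos g hy).le) (hI i)] at hi0
  -- By continuity, vanishing almost everywhere on an open set is vanishing everywhere, in
  -- particular at `p`.
  have h6 := Measure.eqOn_open_of_ae_eq hi0 (isOpen_dom i)
    (((hρc i i).mul (continuousOn_vecDiv hX i)).mul (contDiffOn_volDens g i).continuousOn)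
    continuousOn_const (extChartAt_mem_dom hps)
  simp only [pt_extChartAt hps, Pi.zero_apply, mul_eq_zero, hi, false_or,
    (volDens_pos g (extChartAt_mem_dom hps)).ne', or_false] at h6
  exact h6

end DivergenceTheorem

/-! ### Raising an index, and invariance of the operators under local isometries. -/

section Naturality

open Filter Topology

variable {E : Type*} [NormedAddCommGroup E] [NormedSpace ℝ E] [FiniteDimensional ℝ E]
  {G G' : E → E →L[ℝ] E →L[ℝ] ℝ} {U U' : Set E} {y : E}

/-- The field of endomorphisms `A` with `G(A u, v) = φ(u, v)`. -/
def raise (G φ : E → E →L[ℝ] E →L[ℝ] ℝ) (y : E) : E →L[ℝ] E := sharp (G y) ∘L φ y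

section
variable (hG : IsMetricOn G U)
include hG

theorem metric_raise {φ : E → E →L[ℝ] E →L[ℝ] ℝ} (hy : y ∈ U) (u v : E) :
    G y (raise G φ y u) v = φ y u v := by
  simp [raise, (hG.isInner y hy).apply_sharp]

theorem isSymmOn_raise {φ : E → E →L[ℝ] E →L[ℝ] ℝ} (hφ : ContDiffOn ℝ ∞ φ U)
    (hs : ∀ y ∈ U, ∀ u v, φ y u v = φ y v u) : IsSymmOn G (raise G φ) U where
  smooth := hG.contDiffOn_sharp.clm_comp hφ
  symm y hy u v := by
    rw [metric_raise hG hy, (hG.isInner y hy).symm, metric_raise hG hy, hs y hy]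

/-- The covariant derivative of a symmetric 2-tensor, in terms of the associated endomorphisms. -/
theorem metric_covEndo {A : E → E →L[ℝ] E} (hy : y ∈ U) (hA : DifferentiableAt ℝ A y)
    (a u v : E) : G y (covEndo (chr G) A y a u) v = fderiv ℝ (fun z => G z (A z u) v) y a
      - (G y (A y (chr G y a u)) v + G y (A y u) (chr G y a v)) := by
  have h1 := ((hG.differentiableAt hy).hasFDerivAt.clm_apply
    (hA.hasFDerivAt.clm_apply (hasFDerivAt_const u y))).clm_apply (hasFDerivAt_const v y)
  have h2 := congrArg (fun f : E →L[ℝ] ℝ => f a) h1.fderiv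
  rw [h2]
  simp [covEndo_apply, hG.fderiv_eq hy]
  ring

theorem metric_covBil_eq {N : E → E →L[ℝ] E →L[ℝ] E} (hy : y ∈ U) (hN : DifferentiableAt ℝ N y)
    (a u v w : E) : G y (covBil (chr G) N y a u v) w = fderiv ℝ (fun z => G z (N z u v) w) y a
      - (G y (N y (chr G y a u) v) w + G y (N y u (chr G y a v)) w
        + G y (N y u v) (chr G y a w)) := by
  have h1 := ((hG.differentiableAt hy).hasFDerivAt.clm_apply
    ((hN.hasFDerivAt.clm_apply (hasFDerivAt_const u y)).clm_apply
      (hasFDerivAt_const v y))).clm_apply (hasFDerivAt_const w y)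
  have h2 := congrArg (fun f : E →L[ℝ] ℝ => f a) h1.fderiv
  rw [h2]
  simp [covBil, hG.fderiv_eq hy]
  ring

end

namespace IsIsometryAt

variable {Ψ : E → E} (hΨ : IsIsometryAt G G' Ψ y)
include hΨ

theorem ext_pullback (hG : IsInner (G y)) (hG' : IsInner (G' (Ψ y))) {u v : E}
    (h : ∀ w, G' (Ψ y) u (fderiv ℝ Ψ y w) = G' (Ψ y) v (fderiv ℝ Ψ y w)) : u = v := by
  obtain ⟨L, hL⟩ := hΨ.exists_equiv hG
  refine hG'.ext fun w => ?_
  obtain ⟨w, rfl⟩ := L.surjective w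
  have hw : L w = fderiv ℝ Ψ y w := by rw [← hL]; rfl
  rw [hw, h]

theorem fderiv_sharp (hG : IsInner (G y)) (hG' : IsInner (G' (Ψ y))) {α α' : E →L[ℝ] ℝ}
    (h : ∀ v, α v = α' (fderiv ℝ Ψ y v)) :
    fderiv ℝ Ψ y (sharp (G y) α) = sharp (G' (Ψ y)) α' := by
  refine hΨ.ext_pullback hG hG' fun w => ?_
  rw [← hΨ.pullback.self_of_nhds, hG.apply_sharp, hG'.apply_sharp, h]

theorem fderiv_raise (hG : IsInner (G y)) (hG' : IsInner (G' (Ψ y)))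
    {φ φ' : E → E →L[ℝ] E →L[ℝ] ℝ}
    (h : ∀ u v, φ y u v = φ' (Ψ y) (fderiv ℝ Ψ y u) (fderiv ℝ Ψ y v)) (u : E) :
    fderiv ℝ Ψ y (raise G φ y u) = raise G' φ' (Ψ y) (fderiv ℝ Ψ y u) :=
  hΨ.fderiv_sharp hG hG' fun v => h u v

variable (hG : IsMetricOn G U) (hy : y ∈ U) (hG' : IsMetricOn G' U') (hy' : Ψ y ∈ U')
  {A A' : E → E →L[ℝ] E} (hA : DifferentiableAt ℝ A y) (hA' : DifferentiableAt ℝ A' (Ψ y))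
  (h : ∀ᶠ z in 𝓝 y, ∀ v, fderiv ℝ Ψ z (A z v) = A' (Ψ z) (fderiv ℝ Ψ z v))
include hG hy hG' hy' hA hA' h

theorem divEndo_eq (v : E) : divEndo G A y v = divEndo G' A' (Ψ y) (fderiv ℝ Ψ y v) := by
  obtain ⟨L, hL⟩ := hΨ.exists_equiv (hG.isInner y hy)
  rw [divEndo_apply, divEndo_apply]
  refine traceL_eq_of_conj L fun u => ?_
  have := hΨ.fderiv_covEndo hG hy hG' hy' hA hA' h u v
  have hL' : ∀ w, fderiv ℝ Ψ y w = L w := fun w => by rw [← hL]; rfl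
  simpa only [hL', ContinuousLinearMap.flip_apply] using this

theorem fderiv_divVec : fderiv ℝ Ψ y (divVec G A y) = divVec G' A' (Ψ y) := by
  rw [divVec, divVec, map_smul, hΨ.fderiv_sharp (hG.isInner y hy) (hG'.isInner _ hy')
    (hΨ.divEndo_eq hG hy hG' hy' hA hA' h)]

theorem fderiv_sinOp (u v : E) : fderiv ℝ Ψ y (sinOp G A y u v)
    = sinOp G' A' (Ψ y) (fderiv ℝ Ψ y u) (fderiv ℝ Ψ y v) := by
  simp only [sinOp, sub_apply, map_sub, symProd_apply, map_add, map_smul]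
  rw [hΨ.fderiv_covEndo hG hy hG' hy' hA hA' h, hΨ.fderiv_divVec hG hy hG' hy' hA hA' h,
    hΨ.pullback.self_of_nhds, hΨ.pullback.self_of_nhds,
    hΨ.fderiv_divVec hG hy hG' hy' hA hA' h]

theorem fderiv_sharp_pairForm : fderiv ℝ Ψ y (sharp (G y) (pairForm G A y))
    = sharp (G' (Ψ y)) (pairForm G' A' (Ψ y)) := by
  obtain ⟨L, hL⟩ := hΨ.exists_equiv (hG.isInner y hy)
  refine hΨ.fderiv_sharp (hG.isInner y hy) (hG'.isInner _ hy') fun v => ?_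
  rw [pairForm_apply, pairForm_apply]
  refine traceL_eq_of_conj L fun u => ?_
  have h1 := hΨ.fderiv_sinOp hG hy hG' hy' hA hA' h v (A y u)
  rw [h.self_of_nhds] at h1
  have hL' : ∀ w, L w = fderiv ℝ Ψ y w := fun w => by rw [← hL]; rfl
  simpa only [hL', ContinuousLinearMap.comp_apply] using h1

theorem fderiv_bochnerVec : fderiv ℝ Ψ y (bochnerVec G A y) = bochnerVec G' A' (Ψ y) := by
  obtain ⟨L, hL⟩ := hΨ.exists_equiv (hG.isInner y hy)
  have htr : traceL (A y) = traceL (A' (Ψ y)) := by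
    refine traceL_eq_of_conj L fun u => ?_
    have h1 := h.self_of_nhds u
    rw [← hL] at h1
    exact h1
  rw [bochnerVec, bochnerVec, map_sub, map_smul, map_smul, h.self_of_nhds,
    hΨ.fderiv_divVec hG hy hG' hy' hA hA' h, htr]

end IsIsometryAt

end Naturality

/-! ### Derivatives of multilinear forms, and the action of endomorphisms on them. -/

section Multilinear

variable {E : Type*} [NormedAddCommGroup E] [NormedSpace ℝ E] {k : ℕ}

/-- The derivative of a field of multilinear forms. -/
def multDeriv (F : E → MultilinearMap ℝ (fun _ : Fin k => E) ℝ) (y : E)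
    (hF : ∀ w, DifferentiableAt ℝ (fun z => F z w) y) :
    E →ₗ[ℝ] MultilinearMap ℝ (fun _ : Fin k => E) ℝ where
  toFun u := MultilinearMap.mk' (fun w => fderiv ℝ (fun z => F z w) y u)
    (by
      intro w i a b
      simp only [MultilinearMap.map_update_add]
      rw [fderiv_fun_add (hF _) (hF _)]
      rfl)
    (by
      intro w i c a
      simp only [MultilinearMap.map_update_smul, smul_eq_mul]
      rw [fderiv_const_mul (hF _)]
      rfl)
  map_add' u u' := by ext w; simp
  map_smul' c u := by ext w; simp

theorem multDeriv_apply (F : E → MultilinearMap ℝ (fun _ : Fin k => E) ℝ) (y : E)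
    (hF : ∀ w, DifferentiableAt ℝ (fun z => F z w) y) (u : E) (w : Fin k → E) :
    multDeriv F y hF u w = fderiv ℝ (fun z => F z w) y u := rfl

theorem update_id_apply (s : Fin k) (L : E →ₗ[ℝ] E) (w : Fin k → E) :
    (fun i => (Function.update (fun _ : Fin k => LinearMap.id) s L i) (w i))
      = Function.update w s (L (w s)) := by
  funext i
  rcases eq_or_ne i s with rfl | h
  · simp
  · simp [h]

/-- The action of endomorphisms `Γ u` on a multilinear form, by derivations. -/
def multAct (F : MultilinearMap ℝ (fun _ : Fin k => E) ℝ) (Γ : E →L[ℝ] E →L[ℝ] E) :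
    E →ₗ[ℝ] MultilinearMap ℝ (fun _ : Fin k => E) ℝ where
  toFun u := ∑ s, F.compLinearMap
    (Function.update (fun _ => LinearMap.id) s (Γ u : E →ₗ[ℝ] E))
  map_add' u u' := by
    rw [← Finset.sum_add_distrib]
    refine Finset.sum_congr rfl fun s _ => ?_
    ext w
    simp [update_id_apply]
  map_smul' c u := by
    simp only [RingHom.id_apply]
    rw [Finset.smul_sum]
    refine Finset.sum_congr rfl fun s _ => ?_
    ext w
    simp [update_id_apply]

theorem multAct_apply (F : MultilinearMap ℝ (fun _ : Fin k => E) ℝ) (Γ : E →L[ℝ] E →L[ℝ] E)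
    (u : E) (w : Fin k → E) :
    multAct F Γ u w = ∑ s, F (Function.update w s (Γ u (w s))) := by
  simp only [multAct, LinearMap.coe_mk, AddHom.coe_mk, sum_apply]
  refine Finset.sum_congr rfl fun s _ => ?_
  rw [MultilinearMap.compLinearMap_apply, update_id_apply]
  rfl

end Multilinear

/-! ### From component formulas to the coordinate-free calculus. -/

section Translation

open Filter Topology

variable {n : ℕ} {M : Type*} [TopologicalSpace M] [ChartedSpace (EuclideanSpace ℝ (Fin n)) M]

/-- The standard basis of the coordinate space. -/
def stdB (n : ℕ) : Module.Basis (Fin n) ℝ (Coord n) := (EuclideanSpace.basisFun (Fin n) ℝ).toBasis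

theorem stdB_apply (i : Fin n) : stdB n i = EuclideanSpace.single i (1 : ℝ) := by
  simp [stdB]

theorem stdB_repr (v : Coord n) (i : Fin n) : (stdB n).repr v i = v i := by
  simp [stdB]

theorem sum_coord_smul (v : Coord n) : ∑ i, v i • stdB n i = v := by
  conv_rhs => rw [← (stdB n).sum_repr v]
  simp only [stdB_repr]

/-- A tensor field in the preferred chart at `c`. -/
def localTensor {k : ℕ} (c : M) (T : (p : M) → Tensor n k p) (y : Coord n) :
    MultilinearMap ℝ (fun _ : Fin k => Coord n) ℝ :=
  (show MultilinearMap ℝ (fun _ : Fin k => Coord n) ℝ from T (pt c y)).compLinearMap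
    fun _ => (dpt c y : Coord n →ₗ[ℝ] Coord n)

theorem component_eq {k : ℕ} (c : M) (T : (p : M) → Tensor n k p) (J : Fin k → Fin n)
    (y : Coord n) : component c T J y = localTensor c T y fun s => stdB n (J s) := by
  simp only [stdB_apply]
  rfl

theorem ofComponents_frame {k : ℕ} (x : M) (A : (Fin k → Fin n) → ℝ) (J : Fin k → Fin n) :
    ofComponents x A (fun s => frame x (J s)) = A J := by
  classical
  rw [ofComponents, sum_apply]
  rw [Finset.sum_eq_single J]
  · simp [coframe_frame]
  · intro K _ hK
    obtain ⟨s, hs⟩ := Function.ne_iff.1 hK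
    simp only [smul_apply, MultilinearMap.compLinearMap_apply,
      MultilinearMap.mkPiAlgebra_apply, smul_eq_mul, coframe_frame]
    rw [Finset.prod_eq_zero (Finset.mem_univ s) (by simp [hs]), mul_zero]
  · simp

/-- How tensors defined by components are recognised below: it suffices to exhibit a multilinear
form with the same values on basis vectors. This is applied to `covDeriv` and to the Riemann tensor.
-/
theorem ofComponents_eq {k : ℕ} (x : M) (A : (Fin k → Fin n) → ℝ)
    (F : MultilinearMap ℝ (fun _ : Fin k => Coord n) ℝ)
    (h : ∀ J, F (fun s => stdB n (J s)) = A J) (v : Fin k → TangentSpace (𝓡 n) x) :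
    ofComponents x A v = F v := by
  have : (show MultilinearMap ℝ (fun _ : Fin k => Coord n) ℝ from ofComponents x A) = F := by
    refine Module.Basis.ext_multilinear (fun _ => stdB n) fun J => ?_
    rw [h, ← ofComponents_frame x A J]
    simp only [stdB_apply]
    rfl
  exact congrArg (fun F : MultilinearMap ℝ (fun _ : Fin k => Coord n) ℝ => F v) this

theorem metricTrace_zero [IsManifold (𝓡 n) ∞ M] (g : Metric n M) {k : ℕ} (x : M) :
    metricTrace g (0 : Tensor n (k + 2) x) = 0 := by
  refine Finset.sum_eq_zero fun i _ => Finset.sum_eq_zero fun j _ => ?_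
  have h : ((0 : Tensor n (k + 2) x).curryLeft (frame x i)).curryLeft (frame x j) = 0 := by
    ext w; rfl
  rw [h, smul_zero]

variable [IsManifold (𝓡 n) ∞ M] (g : Metric n M)

/-- The Christoffel symbol in the preferred chart at `c`. -/
abbrev Gam (c : M) : Coord n → Coord n →L[ℝ] Coord n →L[ℝ] Coord n := chr (locMetric g c)

theorem metricMatrix_eq (c : M) (y : Coord n) :
    metricMatrix g c y = gram (stdB n) (locMetric g c y) := by
  ext i j
  rw [gram_apply, stdB_apply, stdB_apply]
  rfl

theorem gram_mulVec {b : Coord n →L[ℝ] Coord n →L[ℝ] ℝ} (v : Coord n) (i : Fin n) :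
    ∑ j, gram (stdB n) b i j * v j = b (stdB n i) v := by
  conv_rhs => rw [← sum_coord_smul v]
  simp [gram_apply, mul_comm]

theorem inv_gram_mul {b : Coord n →L[ℝ] Coord n →L[ℝ] ℝ} (hb : IsInner b) (v : Coord n)
    (k : Fin n) : ∑ l, (gram (stdB n) b)⁻¹ k l * b v (stdB n l) = v k := by
  have h1 : (gram (stdB n) b)⁻¹ * gram (stdB n) b = 1 :=
    Matrix.nonsing_inv_mul _ (hb.det_gram_pos (stdB n)).ne'.isUnit
  have h2 : ∀ l, b v (stdB n l) = ((gram (stdB n) b).mulVec v.ofLp) l := fun l => by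
    rw [hb.symm, ← gram_mulVec]; rfl
  have h3 : ∑ l, (gram (stdB n) b)⁻¹ k l * ((gram (stdB n) b).mulVec v.ofLp) l
      = ((gram (stdB n) b)⁻¹.mulVec ((gram (stdB n) b).mulVec v.ofLp)) k := rfl
  simp only [h2, h3, Matrix.mulVec_mulVec, h1, Matrix.one_mulVec]

theorem christoffel_eq {c : M} {y : Coord n} (hy : y ∈ dom c) (k i j : Fin n) :
    christoffel g c k i j y = Gam g c y (stdB n i) (stdB n j) k := by
  have hG := isMetricOn_locMetric g c
  rw [← inv_gram_mul (hG.isInner y hy), christoffel, Finset.mul_sum]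
  refine Finset.sum_congr rfl fun l _ => ?_
  have hd : ∀ a i j, partialDeriv a (fun z => metricMatrix g c z i j) y
      = fderiv ℝ (locMetric g c) y (stdB n a) (stdB n i) (stdB n j) := by
    intro a i j
    rw [← fderiv_apply_const₂ (hG.differentiableAt hy), partialDeriv, stdB_apply a]
    simp only [metricMatrix_eq, gram_apply]
  rw [hG.apply_chr hy, hd, hd, hd, metricMatrix_eq]
  ring

/-- The component formula is linear in the direction and a derivation in the arguments. The
condition `hT` makes the candidate multilinear: with the default value of `fderiv`, additivity in
the arguments could fail. -/
theorem covDeriv_apply {k : ℕ} (T : (p : M) → Tensor n k p) (x : M)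
    (hT : ∀ w, DifferentiableAt ℝ (fun z => localTensor x T z w) (extChartAt (𝓡 n) x x))
    (v : Fin (k + 1) → TangentSpace (𝓡 n) x) :
    covDeriv g T x v
      = fderiv ℝ (fun z => localTensor x T z (Fin.tail v)) (extChartAt (𝓡 n) x x) (v 0)
        - ∑ s : Fin k, localTensor x T (extChartAt (𝓡 n) x x) (Function.update (Fin.tail v) s
            (Gam g x (extChartAt (𝓡 n) x x) (v 0) (v s.succ))) := by
  set y := extChartAt (𝓡 n) x x with hy
  have hyd : y ∈ dom x := center_mem x
  set F : MultilinearMap ℝ (fun _ : Fin (k + 1) => Coord n) ℝ :=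
    (multDeriv (localTensor x T) y hT
      - multAct (localTensor x T y) (Gam g x y)).uncurryLeft with hF
  have hFv : ∀ v : Fin (k + 1) → Coord n, F v
      = fderiv ℝ (fun z => localTensor x T z (Fin.tail v)) y (v 0)
        - ∑ s : Fin k, localTensor x T y (Function.update (Fin.tail v) s
            (Gam g x y (v 0) (v s.succ))) := by
    intro v
    rw [hF, LinearMap.uncurryLeft_apply, LinearMap.sub_apply, sub_apply,
      multDeriv_apply, multAct_apply]
    rfl
  refine (ofComponents_eq x _ F (fun J => ?_) v).trans (hFv v)
  rw [hFv]
  congr 1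
  · rw [partialDeriv, ← stdB_apply]
    have h : component x T (Fin.tail fun i => J i)
        = fun z => localTensor x T z (Fin.tail fun s => stdB n (J s)) :=
      funext fun z => component_eq x T _ z
    exact congrArg (fun f => fderiv ℝ f y (stdB n (J 0))) h.symm
  · refine Finset.sum_congr rfl fun s _ => ?_
    conv_lhs => rw [← sum_coord_smul (Gam g x y (stdB n (J 0)) (stdB n (J s.succ)))]
    rw [MultilinearMap.map_update_sum]
    refine Finset.sum_congr rfl fun l _ => ?_
    rw [MultilinearMap.map_update_smul, smul_eq_mul, christoffel_eq g hyd, component_eq]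
    congr 2
    funext i
    rcases eq_or_ne i s with rfl | h
    · simp
    · simp [h, Fin.tail]

theorem covDeriv_zero {k : ℕ} (x : M) :
    covDeriv g (fun p : M => (0 : Tensor n k p)) x = 0 := by
  have h0 : ∀ z : Coord n, localTensor x (fun p : M => (0 : Tensor n k p)) z = 0 := fun z => by
    ext w; rfl
  ext v
  rw [covDeriv_apply g _ x (fun w => by simp [h0])]
  simp [h0]
  rfl

/-- The curvature as a multilinear form. -/
def curvForm (c : M) (y : Coord n) : MultilinearMap ℝ (fun _ : Fin 4 => Coord n) ℝ :=
  MultilinearMap.mk' (fun v => locMetric g c y (curv (Gam g c) y (v 0) (v 1) (v 2)) (v 3))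
    (by intro m i a b; fin_cases i <;> simp [curv] <;> ring)
    (by intro m i c a; fin_cases i <;> simp [curv] <;> ring)

theorem riemannTensor_apply (x : M) (v : Fin 4 → TangentSpace (𝓡 n) x) :
    riemannTensor g x v = locMetric g x (extChartAt (𝓡 n) x x)
      (curv (Gam g x) (extChartAt (𝓡 n) x x) (v 0) (v 1) (v 2)) (v 3) := by
  set y := extChartAt (𝓡 n) x x with hy
  have hyd : y ∈ dom x := center_mem x
  have hΓ : DifferentiableAt ℝ (Gam g x) y :=
    ((isMetricOn_locMetric g x).contDiffOn_chr.contDiffAt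
      ((isOpen_dom x).mem_nhds hyd)).differentiableAt (by simp)
  refine (ofComponents_eq x _ (curvForm g x y) (fun J => ?_) v).trans rfl
  have hc : ∀ m k i j, curvatureComponent g x m k i j y
      = curv (Gam g x) y (stdB n i) (stdB n j) (stdB n k) m := by
    intro m k i j
    have hp : ∀ a i j m, partialDeriv a (christoffel g x m i j) y
        = fderiv ℝ (Gam g x) y (stdB n a) (stdB n i) (stdB n j) m := by
      intro a i j m
      have h1 : christoffel g x m i j =ᶠ[𝓝 y] fun z =>
          (EuclideanSpace.proj m : Coord n →L[ℝ] ℝ) (Gam g x z (stdB n i) (stdB n j)) := by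
        filter_upwards [(isOpen_dom x).mem_nhds hyd] with z hz
        rw [christoffel_eq g hz]; rfl
      rw [partialDeriv, h1.fderiv_eq, ← stdB_apply]
      have h2 := ((EuclideanSpace.proj m : Coord n →L[ℝ] ℝ).hasFDerivAt.comp y
        ((hΓ.clm_apply (differentiableAt_const (stdB n i))).clm_apply
          (differentiableAt_const (stdB n j))).hasFDerivAt).fderiv
      have h3 := congrArg (fun f : Coord n →L[ℝ] ℝ => f (stdB n a)) h2
      refine h3.trans ?_
      rw [ContinuousLinearMap.comp_apply, fderiv_apply_const₂ hΓ]
      rfl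
    have hq : ∀ i j k, ∑ p, christoffel g x m i p y * christoffel g x p j k y
        = Gam g x y (stdB n i) (Gam g x y (stdB n j) (stdB n k)) m := by
      intro i j k
      conv_rhs => rw [← sum_coord_smul (Gam g x y (stdB n j) (stdB n k))]
      simp [christoffel_eq g hyd, mul_comm]
    rw [curvatureComponent, Finset.sum_sub_distrib, hp, hp, hq, hq]
    simp only [curv, PiLp.sub_apply, PiLp.add_apply]
    ring
  have h4 : ∀ m, g.inner x (frame x m) (frame x (J 3))
      = locMetric g x y (stdB n m) (stdB n (J 3)) := by
    intro m
    rw [locMetric, localForm_center, stdB_apply, stdB_apply]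
    rfl
  refine Eq.trans ?_ (Finset.sum_congr rfl fun m _ => congrArg₂ (· * ·) (hc m _ _ _) (h4 m)).symm
  change locMetric g x y (curv (Gam g x) y (stdB n (J 0)) (stdB n (J 1)) (stdB n (J 2)))
    (stdB n (J 3)) = _
  conv_lhs => rw [← sum_coord_smul (curv (Gam g x) y (stdB n (J 0)) (stdB n (J 1)) (stdB n (J 2)))]
  simp

/-- If the rows of `C` are the coordinates of the vectors of `e`, orthonormality reads `C · gram ·
Cᵀ = 1`, so the inverse Gram matrix is `Cᵀ C`. -/
theorem sum_orthonormal_eq {W : Type*} [AddCommGroup W] [Module ℝ W]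
    {b : Coord n →L[ℝ] Coord n →L[ℝ] ℝ} {ι : Type*} [Fintype ι] [DecidableEq ι]
    {e : Module.Basis ι ℝ (Coord n)} (he : ∀ i j, b (e i) (e j) = if i = j then 1 else 0)
    (B : Coord n →ₗ[ℝ] Coord n →ₗ[ℝ] W) :
    ∑ i, ∑ j, (gram (stdB n) b)⁻¹ i j • B (stdB n i) (stdB n j) = ∑ a, B (e a) (e a) := by
  let σ : ι ≃ Fin n := e.indexEquiv (stdB n)
  set C : Matrix (Fin n) (Fin n) ℝ := Matrix.of fun a i => e (σ.symm a) i with hC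
  have h1 : C * (gram (stdB n) b * C.transpose) = 1 := by
    ext a c
    have h2 : ∀ i, (gram (stdB n) b * C.transpose) i c = b (stdB n i) (e (σ.symm c)) := by
      intro i
      rw [← gram_mulVec]
      rfl
    rw [Matrix.mul_apply]
    simp only [h2]
    have h3 : ∑ i, C a i * b (stdB n i) (e (σ.symm c)) = b (e (σ.symm a)) (e (σ.symm c)) := by
      conv_rhs => rw [← sum_coord_smul (e (σ.symm a))]
      simp [hC]
    rw [h3, he, Matrix.one_apply]
    simp
  have h2 : (gram (stdB n) b)⁻¹ = C.transpose * C := by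
    refine Matrix.inv_eq_right_inv ?_
    rw [← mul_assoc, mul_eq_one_comm, h1]
  rw [h2, ← σ.symm.sum_comp]
  have h3 : ∀ a, B (e (σ.symm a)) (e (σ.symm a))
      = ∑ i, ∑ j, (C a i * C a j) • B (stdB n i) (stdB n j) := by
    intro a
    conv_lhs => rw [← sum_coord_smul (e (σ.symm a))]
    simp only [map_sum, map_smul, LinearMap.sum_apply, LinearMap.smul_apply, Finset.smul_sum,
      smul_smul]
    rw [Finset.sum_comm]
    refine Finset.sum_congr rfl fun i _ => Finset.sum_congr rfl fun j _ => ?_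
    rw [mul_comm]
    rfl
  simp only [h3, Matrix.mul_apply, Matrix.transpose_apply, Finset.sum_smul]
  calc _ = ∑ i, ∑ a, ∑ j, (C a i * C a j) • B (stdB n i) (stdB n j) :=
        Finset.sum_congr rfl fun i _ => Finset.sum_comm
    _ = _ := Finset.sum_comm

/-- The metric trace is a sum over an orthonormal basis. -/
theorem metricTrace_apply {k : ℕ} {x : M} {ι : Type*} [Fintype ι] [DecidableEq ι]
    {e : Module.Basis ι ℝ (Coord n)}
    (he : ∀ i j, modelForm g.inner x (e i) (e j) = if i = j then 1 else 0)
    (T : Tensor n (k + 2) x) (w : Fin k → TangentSpace (𝓡 n) x) :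
    metricTrace g T w = ∑ a, T (Fin.cons (e a) (Fin.cons (e a) w)) := by
  let T' : MultilinearMap ℝ (fun _ : Fin (k + 2) => Coord n) ℝ := T
  let B : Coord n →ₗ[ℝ] Coord n →ₗ[ℝ] MultilinearMap ℝ (fun _ : Fin k => Coord n) ℝ :=
    LinearMap.mk₂ ℝ (fun u v => (T'.curryLeft u).curryLeft v)
      (fun a b c => by rw [map_add]; rfl) (fun a b c => by rw [map_smul]; rfl)
      (fun a b c => by rw [map_add]) (fun a b c => by rw [map_smul])
  have h := sum_orthonormal_eq he B
  have hm : (Matrix.of fun a b => g.inner x (frame x a) (frame x b))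
      = gram (stdB n) (modelForm g.inner x) := by
    ext i j
    rw [gram_apply, stdB_apply, stdB_apply]
    rfl
  have h2 : metricTrace g T = ∑ a, B (e a) (e a) := by
    rw [← h, metricTrace, hm]
    simp only [stdB_apply]
    rfl
  refine (congrArg (fun F : MultilinearMap ℝ (fun _ : Fin k => Coord n) ℝ => F w) h2).trans ?_
  exact sum_apply _ _ _

end Translation

/-! ### The operators `div`, `S`, `S*` in terms of endomorphism fields. -/

section Operators

open Filter Topology

variable {n : ℕ} {M : Type*} [TopologicalSpace M] [ChartedSpace (EuclideanSpace ℝ (Fin n)) M]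
  [IsManifold (𝓡 n) ∞ M] (g : Metric n M) (φ : SymmTwoTensor n M)

/-- The field of symmetric endomorphisms associated with `φ`, in the preferred chart at `c`. -/
def endo (c : M) : Coord n → Coord n →L[ℝ] Coord n :=
  raise (locMetric g c) (localForm φ.form c)

theorem isSymmOn_endo (c : M) : IsSymmOn (locMetric g c) (endo g φ c) (dom c) :=
  isSymmOn_raise (isMetricOn_locMetric g c) (contDiffOn_localForm φ.contMDiff c)
    fun y _ u v => φ.symm (pt c y) (dpt c y u) (dpt c y v)

theorem endo_differentiableAt {c : M} {y : Coord n} (hy : y ∈ dom c) :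
    DifferentiableAt ℝ (endo g φ c) y :=
  symmEndo_differentiableAt (isMetricOn_locMetric g c) (isSymmOn_endo g φ c) hy

theorem metric_endo {c : M} {y : Coord n} (hy : y ∈ dom c) (u v : Coord n) :
    locMetric g c y (endo g φ c y u) v = localForm φ.form c y u v :=
  metric_raise (isMetricOn_locMetric g c) hy u v

theorem eventually_endo_trans {c c' : M} {y : Coord n} (hy : y ∈ dom c)
    (hy' : pt c y ∈ (extChartAt (𝓡 n) c').source) :
    ∀ᶠ z in 𝓝 y, ∀ v, fderiv ℝ (trans c c') z (endo g φ c z v)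
      = endo g φ c' (trans c c' z) (fderiv ℝ (trans c c') z v) := by
  filter_upwards [eventually_pt_mem hy (isOpen_extChartAt_source c') hy'] with z hz v
  exact (isIsometryAt_trans g hz.1 hz.2).fderiv_raise ((isMetricOn_locMetric g c).isInner z hz.1)
    ((isMetricOn_locMetric g c').isInner _ (trans_mem hz.2)) (localForm_trans φ.form hz.1 hz.2) v

theorem endo_trans {c c' : M} {y : Coord n} (hy : y ∈ dom c)
    (hy' : pt c y ∈ (extChartAt (𝓡 n) c').source) (v : Coord n) :
    fderiv ℝ (trans c c') y (endo g φ c y v)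
      = endo g φ c' (trans c c' y) (fderiv ℝ (trans c c') y v) :=
  (eventually_endo_trans g φ hy hy').self_of_nhds v

theorem sinOp_trans {c c' : M} {y : Coord n} (hy : y ∈ dom c)
    (hy' : pt c y ∈ (extChartAt (𝓡 n) c').source) (u v : Coord n) :
    fderiv ℝ (trans c c') y (sinOp (locMetric g c) (endo g φ c) y u v)
      = sinOp (locMetric g c') (endo g φ c') (trans c c' y) (fderiv ℝ (trans c c') y u)
        (fderiv ℝ (trans c c') y v) :=
  (isIsometryAt_trans g hy hy').fderiv_sinOp (isMetricOn_locMetric g c) hy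
    (isMetricOn_locMetric g c') (trans_mem hy') (endo_differentiableAt g φ hy)
    (endo_differentiableAt g φ (trans_mem hy')) (eventually_endo_trans g φ hy hy') u v

theorem divVec_trans {c c' : M} {y : Coord n} (hy : y ∈ dom c)
    (hy' : pt c y ∈ (extChartAt (𝓡 n) c').source) :
    fderiv ℝ (trans c c') y (divVec (locMetric g c) (endo g φ c) y)
      = divVec (locMetric g c') (endo g φ c') (trans c c' y) :=
  (isIsometryAt_trans g hy hy').fderiv_divVec (isMetricOn_locMetric g c) hy
    (isMetricOn_locMetric g c') (trans_mem hy') (endo_differentiableAt g φ hy)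
    (endo_differentiableAt g φ (trans_mem hy')) (eventually_endo_trans g φ hy hy')

theorem isVecField_pairForm : IsVecField fun c y =>
    sharp (locMetric g c y) (pairForm (locMetric g c) (endo g φ c) y) where
  smooth c := (isMetricOn_locMetric g c).contDiffOn_sharp.clm_apply
    (contDiffOn_pairForm (isMetricOn_locMetric g c) (isSymmOn_endo g φ c))
  natural c c' _ hy hy' := (isIsometryAt_trans g hy hy').fderiv_sharp_pairForm
    (isMetricOn_locMetric g c) hy (isMetricOn_locMetric g c') (trans_mem hy')
    (endo_differentiableAt g φ hy) (endo_differentiableAt g φ (trans_mem hy'))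
    (eventually_endo_trans g φ hy hy')

theorem isVecField_bochnerVec : IsVecField fun c y =>
    bochnerVec (locMetric g c) (endo g φ c) y where
  smooth c := contDiffOn_bochnerVec (isMetricOn_locMetric g c) (isSymmOn_endo g φ c)
  natural c c' _ hy hy' := (isIsometryAt_trans g hy hy').fderiv_bochnerVec
    (isMetricOn_locMetric g c) hy (isMetricOn_locMetric g c') (trans_mem hy')
    (endo_differentiableAt g φ hy) (endo_differentiableAt g φ (trans_mem hy'))
    (eventually_endo_trans g φ hy hy')

theorem fderiv_trans_center {c : M} {y : Coord n} (hy : y ∈ dom c) (u : Coord n) :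
    fderiv ℝ (trans c (pt c y)) y u = dpt c y u := by
  have h := dpt_comp_fderiv_trans hy (c' := pt c y) (mem_extChartAt_source _) u
  rw [← h]
  exact (dpt_center (pt c y) _).symm

/-- A covariant tensor at `x`, as a multilinear form on the model space. -/
def modelTensor {k : ℕ} {x : M} (T : Tensor n k x) :
    MultilinearMap ℝ (fun _ : Fin k => Coord n) ℝ := T

omit [IsManifold (𝓡 n) ∞ M] in
theorem modelTensor_injective {k : ℕ} {x : M} {T T' : Tensor n k x}
    (h : modelTensor T = modelTensor T') : T = T' := h

theorem modelTensor_covDeriv {k : ℕ} (T : (p : M) → Tensor n k p) (x : M)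
    (hT : ∀ w, DifferentiableAt ℝ (fun z => localTensor x T z w) (extChartAt (𝓡 n) x x))
    (v : Fin (k + 1) → Coord n) :
    modelTensor (covDeriv g T x) v
      = fderiv ℝ (fun z => localTensor x T z (Fin.tail v)) (extChartAt (𝓡 n) x x) (v 0)
        - ∑ s : Fin k, localTensor x T (extChartAt (𝓡 n) x x) (Function.update (Fin.tail v) s
            (Gam g x (extChartAt (𝓡 n) x x) (v 0) (v s.succ))) :=
  covDeriv_apply g T x hT v

theorem localTensor_toTensor {c : M} {y : Coord n} (hy : y ∈ dom c) (w : Fin 2 → Coord n) :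
    localTensor c (toTensor φ) y w = locMetric g c y (endo g φ c y (w 0)) (w 1) := by
  rw [metric_endo g φ hy]
  rfl

theorem covDeriv_toTensor (x : M) (v : Fin 3 → Coord n) :
    modelTensor (covDeriv g (toTensor φ) x) v = locMetric g x (extChartAt (𝓡 n) x x)
      (covEndo (Gam g x) (endo g φ x) (extChartAt (𝓡 n) x x) (v 0) (v 1)) (v 2) := by
  have hyd := center_mem (n := n) x
  have hG := isMetricOn_locMetric g x
  have hA := endo_differentiableAt g φ hyd
  have h1 : ∀ w : Fin 2 → Coord n, (fun z => localTensor x (toTensor φ) z w)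
      =ᶠ[𝓝 (extChartAt (𝓡 n) x x)] fun z => locMetric g x z (endo g φ x z (w 0)) (w 1) := by
    intro w
    filter_upwards [(isOpen_dom x).mem_nhds hyd] with z hz using localTensor_toTensor g φ hz w
  rw [modelTensor_covDeriv g _ x]
  · rw [metric_covEndo hG hyd hA, (h1 _).fderiv_eq, Fin.sum_univ_two,
      localTensor_toTensor g φ hyd, localTensor_toTensor g φ hyd]
    rfl
  · intro w
    refine DifferentiableAt.congr_of_eventuallyEq ?_ (h1 w)
    exact ((hG.differentiableAt hyd).clm_apply (hA.clm_apply (differentiableAt_const _))).clm_apply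
      (differentiableAt_const _)

theorem exists_orthonormal_center (x : M) :
    ∃ e : Module.Basis (Fin (Module.finrank ℝ (Coord n))) ℝ (Coord n),
      ∀ i j, locMetric g x (extChartAt (𝓡 n) x x) (e i) (e j) = if i = j then 1 else 0 :=
  ((isMetricOn_locMetric g x).isInner _ (center_mem x)).exists_orthonormalBasis

theorem modelTensor_metricTrace {k : ℕ} {x : M} {ι : Type*} [Fintype ι] [DecidableEq ι]
    {e : Module.Basis ι ℝ (Coord n)}
    (he : ∀ i j, locMetric g x (extChartAt (𝓡 n) x x) (e i) (e j) = if i = j then 1 else 0)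
    (T : Tensor n (k + 2) x) (w : Fin k → Coord n) :
    modelTensor (metricTrace g T) w = ∑ a, modelTensor T (Fin.cons (e a) (Fin.cons (e a) w)) := by
  refine metricTrace_apply g (fun i j => ?_) T w
  rw [← he, locMetric, localForm_center]

theorem modelTensor_divergence (x : M) (w : Fin 1 → Coord n) :
    modelTensor (divergence g φ x) w
      = divEndo (locMetric g x) (endo g φ x) (extChartAt (𝓡 n) x x) (w 0) := by
  obtain ⟨e, he⟩ := exists_orthonormal_center g x
  have hI := (isMetricOn_locMetric g x).isInner _ (center_mem x)
  rw [divergence, modelTensor_metricTrace g he, divEndo_apply, traceL_eq_sum he]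
  refine Finset.sum_congr rfl fun a _ => ?_
  rw [covDeriv_toTensor]
  -- The metric trace contracts the direction with the first argument, while `divEndo` contracts it
  -- with the value of `∇A`; the symmetry of `∇_u A` reconciles them.
  exact (covEndo_symm (isMetricOn_locMetric g x) (isSymmOn_endo g φ x) (center_mem x) _ _ _).trans
    (hI.symm _ _)

theorem opS_apply (x : M) (v : Fin 3 → Coord n) :
    modelTensor (opS g φ x) v = locMetric g x (extChartAt (𝓡 n) x x)
      (sinOp (locMetric g x) (endo g φ x) (extChartAt (𝓡 n) x x) (v 0) (v 1)) (v 2) := by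
  have hG := isMetricOn_locMetric g x
  have hx := center_mem (n := n) x
  have h1 : modelTensor (opS g φ x) v
      = modelTensor (covDeriv g (toTensor φ) x) v - (1 / ((n : ℝ) + 1)) *
      (modelForm g.inner x (v 0) (v 1) * modelTensor (divergence g φ x) (fun _ => v 2)
        + modelForm g.inner x (v 0) (v 2) * modelTensor (divergence g φ x) (fun _ => v 1)) := rfl
  have h3 : modelForm g.inner x = locMetric g x (extChartAt (𝓡 n) x x) :=
    (localForm_center g.inner x).symm
  rw [h1, covDeriv_toTensor, modelTensor_divergence, modelTensor_divergence, h3, sinOp]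
  have h4 := metric_divVec (A := endo g φ x) hG hx
  rw [finrank_euclideanSpace_fin] at h4
  simp only [sub_apply, map_sub, symProd_apply, map_add, map_smul, add_apply, smul_apply,
    smul_eq_mul, h4]
  rw [(hG.isInner _ hx).symm (v 0) (v 2)]
  ring

/-- The value of `opS` at each point is computed in the chart centred there, whereas `covDeriv`
differentiates in one fixed chart. Naturality of `sinOp` gives the expression of `opS` in that
chart. -/
theorem localTensor_opS {c : M} {y : Coord n} (hy : y ∈ dom c) (v : Fin 3 → Coord n) :
    localTensor c (opS g φ) y v = locMetric g c y
      (sinOp (locMetric g c) (endo g φ c) y (v 0) (v 1)) (v 2) := by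
  have hy' : pt c y ∈ (extChartAt (𝓡 n) (pt c y)).source := mem_extChartAt_source _
  have h1 : localTensor c (opS g φ) y v
      = modelTensor (opS g φ (pt c y)) (fun s => dpt c y (v s)) := rfl
  rw [h1, opS_apply, ((isIsometryAt_trans g hy hy').pullback).self_of_nhds,
    sinOp_trans g φ hy hy', fderiv_trans_center hy, fderiv_trans_center hy,
    fderiv_trans_center hy]
  rfl

theorem metricTrace_opS (x : M) : metricTrace g (opS g φ x) = 0 := by
  obtain ⟨e, he⟩ := exists_orthonormal_center g x
  have hG := isMetricOn_locMetric g x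
  have hx := center_mem (n := n) x
  refine modelTensor_injective (MultilinearMap.ext fun w => ?_)
  rw [modelTensor_metricTrace g he]
  have h := traceL_sinOp_flip (A := endo g φ x) hG hx (w 0)
  rw [traceL_eq_sum he] at h
  refine Eq.trans (Finset.sum_congr rfl fun a _ => ?_) h
  rw [opS_apply]
  exact (sinOp_symm hG (isSymmOn_endo g φ x) hx _ _ _).trans ((hG.isInner _ hx).symm _ _)

/-- On the image of `S` the second term of `S*` drops out, because `S` is trace-free. -/
theorem opSStar_opS (x : M) :
    opSStar g (opS g φ) x = -metricTrace g (covDeriv g (opS g φ) x) := by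
  have h : (fun p => metricTrace g (opS g φ p)) = fun p : M => (0 : Tensor n 1 p) :=
    funext fun p => metricTrace_opS g φ p
  have h2 : ((0 : Tensor n 2 x).domDomCongr (Equiv.swap 0 1)) = 0 := rfl
  rw [opSStar, h, covDeriv_zero, h2, add_zero, smul_zero, add_zero]

theorem covDeriv_opS (x : M) (v : Fin 4 → Coord n) :
    modelTensor (covDeriv g (opS g φ) x) v = locMetric g x (extChartAt (𝓡 n) x x)
      (covBil (Gam g x) (sinOp (locMetric g x) (endo g φ x)) (extChartAt (𝓡 n) x x)
        (v 0) (v 1) (v 2)) (v 3) := by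
  have hyd := center_mem (n := n) x
  have hG := isMetricOn_locMetric g x
  have hN : DifferentiableAt ℝ (sinOp (locMetric g x) (endo g φ x)) (extChartAt (𝓡 n) x x) :=
    ((contDiffOn_sinOp hG (isSymmOn_endo g φ x)).contDiffAt (hG.mem_nhds hyd)).differentiableAt
      (by simp)
  have h1 : ∀ w : Fin 3 → Coord n, (fun z => localTensor x (opS g φ) z w)
      =ᶠ[𝓝 (extChartAt (𝓡 n) x x)] fun z =>
        locMetric g x z (sinOp (locMetric g x) (endo g φ x) z (w 0) (w 1)) (w 2) := by
    intro w
    filter_upwards [(isOpen_dom x).mem_nhds hyd] with z hz using localTensor_opS g φ hz w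
  rw [modelTensor_covDeriv g _ x]
  · rw [metric_covBil_eq hG hyd hN, (h1 _).fderiv_eq, Fin.sum_univ_three,
      localTensor_opS g φ hyd, localTensor_opS g φ hyd, localTensor_opS g φ hyd]
    rfl
  · intro w
    refine DifferentiableAt.congr_of_eventuallyEq ?_ (h1 w)
    exact ((hG.differentiableAt hyd).clm_apply ((hN.clm_apply (differentiableAt_const _)).clm_apply
      (differentiableAt_const _))).clm_apply (differentiableAt_const _)

theorem sum_covBil_sinOp_of_mem_kerSStarS {φ : SymmTwoTensor n M} (hφ : φ ∈ kerSStarS g) {x : M}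
    {ι : Type*} [Fintype ι] [DecidableEq ι] {e : Module.Basis ι ℝ (Coord n)}
    (he : ∀ i j, locMetric g x (extChartAt (𝓡 n) x x) (e i) (e j) = if i = j then 1 else 0)
    (v w : Coord n) :
    ∑ i, locMetric g x (extChartAt (𝓡 n) x x)
      (covBil (Gam g x) (sinOp (locMetric g x) (endo g φ x)) (extChartAt (𝓡 n) x x)
        (e i) (e i) v) w = 0 := by
  have h1 : metricTrace g (covDeriv g (opS g φ) x) = 0 :=
    neg_eq_zero.1 ((opSStar_opS g φ x).symm.trans (hφ x))
  have h2 := modelTensor_metricTrace g he (covDeriv g (opS g φ) x) ![v, w]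
  rw [h1] at h2
  refine Eq.trans (Finset.sum_congr rfl fun a _ => ?_) h2.symm
  rw [covDeriv_opS]
  rfl

/-- The sign of the curvature form is the sign of the sectional curvature. -/
theorem sectionalCurvature_eq (x : M) (u v : Coord n) :
    sectionalCurvature g x u v = modelForm g.inner x
      (curv (Gam g x) (extChartAt (𝓡 n) x x) u v v) u /
      (modelForm g.inner x u u * modelForm g.inner x v v - modelForm g.inner x u v ^ 2) := by
  have h := riemannTensor_apply g x ![u, v, v, u]
  rw [locMetric, localForm_center] at h
  exact congrArg (· / (modelForm g.inner x u u * modelForm g.inner x v v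
    - modelForm g.inner x u v ^ 2)) h

end Operators

theorem IsInner.gram_pos {E : Type*} [NormedAddCommGroup E] [NormedSpace ℝ E]
    {b : E →L[ℝ] E →L[ℝ] ℝ} (hb : IsInner b) {u v : E} (h : LinearIndependent ℝ ![u, v]) :
    0 < b u u * b v v - b u v ^ 2 := by
  rw [LinearIndependent.pair_iff] at h
  have hv : v ≠ 0 := fun hv => one_ne_zero (h 0 1 (by simp [hv])).2
  have hvv := hb.pos v hv
  -- A multiple of the component of `u` orthogonal to `v`; its positive square is strict
  -- Cauchy–Schwarz.
  have hw : b v v • u + (-b u v) • v ≠ 0 := fun h0 => hvv.ne' (h _ _ h0).1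
  have h1 := hb.pos _ hw
  have h2 : b (b v v • u + (-b u v) • v) (b v v • u + (-b u v) • v)
      = b v v * (b u u * b v v - b u v ^ 2) := by
    simp only [map_add, map_smul, add_apply, smul_apply, smul_eq_mul, hb.symm v u]
    ring
  rw [h2] at h1
  exact pos_of_mul_pos_right h1 hvv.le

/-! ### The kernel of `S*S` on a closed manifold. -/

section Kernel

open Filter Topology

variable {n : ℕ} {M : Type*} [TopologicalSpace M] [ChartedSpace (EuclideanSpace ℝ (Fin n)) M]
  [IsManifold (𝓡 n) ∞ M] {g : Metric n M} {φ : SymmTwoTensor n M}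

theorem NonposCurved.curv_nonpos (h : NonposCurved g) (x : M) (u v : Coord n)
    (huv : LinearIndependent ℝ ![u, v]) : locMetric g x (extChartAt (𝓡 n) x x)
      (curv (Gam g x) (extChartAt (𝓡 n) x x) u v v) u ≤ 0 := by
  have h1 := (sectionalCurvature_eq g x u v).symm.trans_le (h x u v huv)
  rw [locMetric, localForm_center]
  rwa [div_le_iff₀ ((isInner_modelForm g x).gram_pos huv), zero_mul] at h1

theorem NegCurvedAt.curv_neg {x : M} (h : NegCurvedAt g x) (u v : Coord n)
    (huv : LinearIndependent ℝ ![u, v]) : locMetric g x (extChartAt (𝓡 n) x x)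
      (curv (Gam g x) (extChartAt (𝓡 n) x x) u v v) u < 0 := by
  have h1 := (sectionalCurvature_eq g x u v).symm.trans_lt (h u v huv)
  rw [locMetric, localForm_center]
  rwa [div_lt_iff₀ ((isInner_modelForm g x).gram_pos huv), zero_mul] at h1

theorem eq_zero_of_fderiv_trans {c : M} {y : Coord n} (hy : y ∈ dom c) {u : Coord n}
    (h : fderiv ℝ (trans c (pt c y)) y u = 0) : u = 0 := by
  rw [fderiv_trans_center hy] at h
  exact dpt_injective hy (h.trans (map_zero _).symm)

variable [T2Space M] [CompactSpace M]

/-- The kernel of `S* S` is the kernel of `S`. -/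
theorem sinOp_eq_zero (hφ : φ ∈ kerSStarS g) {c : M} {y : Coord n} (hy : y ∈ dom c) :
    sinOp (locMetric g c) (endo g φ c) y = 0 := by
  have hsum : ∀ (p : M) {e : Module.Basis (Fin (Module.finrank ℝ (Coord n))) ℝ (Coord n)}
      (_ : ∀ i j, locMetric g p (extChartAt (𝓡 n) p p) (e i) (e j) = if i = j then 1 else 0),
      vecDiv g (fun c y => sharp (locMetric g c y) (pairForm (locMetric g c) (endo g φ c) y)) p
        = ∑ i, ∑ j, locMetric g p (extChartAt (𝓡 n) p p)
          (sinOp (locMetric g p) (endo g φ p) (extChartAt (𝓡 n) p p) (e i) (e j))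
          (sinOp (locMetric g p) (endo g φ p) (extChartAt (𝓡 n) p p) (e i) (e j)) :=
    fun p e he => traceL_covVec_pairForm (isMetricOn_locMetric g p) (isSymmOn_endo g φ p)
      (center_mem p) he (sum_covBil_sinOp_of_mem_kerSStarS g hφ he)
  have hnn : ∀ p, 0 ≤ vecDiv g
      (fun c y => sharp (locMetric g c y) (pairForm (locMetric g c) (endo g φ c) y)) p := by
    intro p
    obtain ⟨e, he⟩ := exists_orthonormal_center g p
    rw [hsum p he]
    exact Finset.sum_nonneg fun i _ => Finset.sum_nonneg fun j _ =>
      ((isMetricOn_locMetric g p).isInner _ (center_mem p)).nonneg _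
  have hcenter : ∀ p : M,
      sinOp (locMetric g p) (endo g φ p) (extChartAt (𝓡 n) p p) = 0 := by
    intro p
    obtain ⟨e, he⟩ := exists_orthonormal_center g p
    have h := vecDiv_eq_zero_of_nonneg g (isVecField_pairForm g φ) hnn p
    rw [hsum p he] at h
    exact sinOp_eq_zero_of_sum (isMetricOn_locMetric g p) (center_mem p) h
  -- So far the vanishing holds at chart centres only; the derivative of the change of charts, being
  -- injective, carries it to every point of every chart.
  ext1 u
  ext1 v
  refine eq_zero_of_fderiv_trans hy ?_
  rw [sinOp_trans g φ hy (mem_extChartAt_source _), trans, hcenter]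
  rfl

theorem divVec_eq_zero (hn : 2 ≤ n) (hsec : NonposCurved g) (hφ : φ ∈ kerSStarS g) {c : M}
    {y : Coord n} (hy : y ∈ dom c) : divVec (locMetric g c) (endo g φ c) y = 0 := by
  have hn' : (2 : ℝ) ≤ n := by exact_mod_cast hn
  -- The coefficient is `(n - 1)(n + 2)`, which is zero for `n = 1`; here `2 ≤ n` is essential.
  have hpos : 0 < (n : ℝ) * (n + 1) - 2 := by nlinarith
  have hI : ∀ p : M, IsInner (locMetric g p (extChartAt (𝓡 n) p p)) := fun p =>
    (isMetricOn_locMetric g p).isInner _ (center_mem p)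
  have hle : ∀ p : M, ((n : ℝ) * (n + 1) - 2) * locMetric g p (extChartAt (𝓡 n) p p)
      (divVec (locMetric g p) (endo g φ p) (extChartAt (𝓡 n) p p))
      (divVec (locMetric g p) (endo g φ p) (extChartAt (𝓡 n) p p))
      ≤ vecDiv g (fun c y => bochnerVec (locMetric g c) (endo g φ c) y) p := by
    intro p
    have h := le_traceL_covVec_bochnerVec (isMetricOn_locMetric g p) (isSymmOn_endo g φ p)
      (center_mem p) (fun z hz => sinOp_eq_zero hφ hz) (hsec.curv_nonpos p)
    rwa [finrank_euclideanSpace_fin] at h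
  have hzero := vecDiv_eq_zero_of_nonneg g (isVecField_bochnerVec g φ)
    fun p => (mul_nonneg hpos.le ((hI p).nonneg _)).trans (hle p)
  have hcenter : ∀ p : M,
      divVec (locMetric g p) (endo g φ p) (extChartAt (𝓡 n) p p) = 0 := by
    intro p
    have h := hle p
    rw [hzero p] at h
    exact (hI p).eq_zero (le_antisymm (nonpos_of_mul_nonpos_right h hpos) ((hI p).nonneg _))
  refine eq_zero_of_fderiv_trans hy ?_
  rw [divVec_trans g φ hy (mem_extChartAt_source _), trans, hcenter]

theorem covEndo_eq_zero (hn : 2 ≤ n) (hsec : NonposCurved g) (hφ : φ ∈ kerSStarS g) {c : M}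
    {y : Coord n} (hy : y ∈ dom c) : covEndo (Gam g c) (endo g φ c) y = 0 := by
  rw [covEndo_eq_symProd (sinOp_eq_zero hφ hy), divVec_eq_zero hn hsec hφ hy]
  ext1 u
  ext1 v
  simp [symProd_apply]

theorem isParallel_of_mem_kerSStarS (hn : 2 ≤ n) (hsec : NonposCurved g) (hφ : φ ∈ kerSStarS g) :
    IsParallel g φ := by
  refine fun x => modelTensor_injective (MultilinearMap.ext fun v => ?_)
  rw [covDeriv_toTensor, covEndo_eq_zero hn hsec hφ (center_mem x)]
  simp
  rfl

omit [T2Space M] [CompactSpace M] in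
-- Chart independence of `tr (A - C)²`, which is thereby a function on `M`.
theorem traceL_sq_endo (g : Metric n M) (φ : SymmTwoTensor n M) (C : ℝ) {c c' : M} {y : Coord n}
    (hy : y ∈ dom c) (hy' : pt c y ∈ (extChartAt (𝓡 n) c').source) :
    traceL ((endo g φ c y - C • ContinuousLinearMap.id ℝ (Coord n)) ∘L
        (endo g φ c y - C • ContinuousLinearMap.id ℝ (Coord n)))
      = traceL ((endo g φ c' (trans c c' y) - C • ContinuousLinearMap.id ℝ (Coord n)) ∘L
        (endo g φ c' (trans c c' y) - C • ContinuousLinearMap.id ℝ (Coord n))) := by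
  obtain ⟨L, hL⟩ := (isIsometryAt_trans g hy hy').exists_equiv
    ((isMetricOn_locMetric g c).isInner y hy)
  have h : ∀ v, L (endo g φ c y v) = endo g φ c' (trans c c' y) (L v) := by
    intro v
    have h1 := endo_trans g φ hy hy' v
    rw [← hL] at h1
    exact h1
  refine traceL_eq_of_conj L fun v => ?_
  simp [h]

omit [T2Space M] [CompactSpace M] in
/-- On a connected manifold, a parallel field of endomorphisms which is a multiple of the identity
at one point is a multiple of the identity. -/
theorem endo_eq_smul [ConnectedSpace M]
    (hN : ∀ (c : M) (y : Coord n), y ∈ dom c → covEndo (Gam g c) (endo g φ c) y = 0) {x : M}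
    {C : ℝ} (hx : ∀ v, endo g φ x (extChartAt (𝓡 n) x x) v = C • v) (p : M) (v : Coord n) :
    endo g φ p (extChartAt (𝓡 n) p p) v = C • v := by
  set f : M → Coord n → ℝ := fun c y =>
    traceL ((endo g φ c y - C • ContinuousLinearMap.id ℝ (Coord n)) ∘L
      (endo g φ c y - C • ContinuousLinearMap.id ℝ (Coord n))) with hf
  have hloc : IsLocallyConstant (fun q : M => f q (extChartAt (𝓡 n) q q)) := by
    rw [IsLocallyConstant.iff_eventually_eq]
    intro q
    -- A ball in coordinates is connected, so a function with zero derivative there is constant;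
    -- chart independence then compares with the values read in the charts centred at nearby points.
    obtain ⟨r, hr, hrd⟩ := Metric.isOpen_iff.1 (isOpen_dom (n := n) q) _ (center_mem q)
    have hd : ∀ y ∈ Metric.ball (extChartAt (𝓡 n) q q) r,
        DifferentiableAt ℝ (endo g φ q) y := fun y hy => endo_differentiableAt g φ (hrd hy)
    have hconst : ∀ y ∈ Metric.ball (extChartAt (𝓡 n) q q) r,
        f q y = f q (extChartAt (𝓡 n) q q) := by
      intro y hy
      refine Metric.isOpen_ball.is_const_of_fderiv_eq_zero (𝕜 := ℝ)
        (convex_ball _ _).isPreconnected (fun z hz => ?_) (fun z hz => ?_) hy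
        (Metric.mem_ball_self hr)
      · have h0 := (hd z hz).sub_const (C • ContinuousLinearMap.id ℝ (Coord n))
        exact ((traceL (E := Coord n)).differentiableAt.comp z
          (h0.clm_comp h0)).differentiableWithinAt
      · exact fderiv_traceL_sq_eq_zero (hd z hz) (hN q z (hrd hz)) C
    have hball := (continuousAt_extChartAt (I := 𝓡 n) q).preimage_mem_nhds
      (Metric.ball_mem_nhds _ hr)
    filter_upwards [hball, extChartAt_source_mem_nhds (I := 𝓡 n) q] with p hp hps
    have h1 := traceL_sq_endo g φ C (extChartAt_mem_dom hps) (c' := p)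
      (by rw [pt_extChartAt hps]; exact mem_extChartAt_source p)
    rw [trans, pt_extChartAt hps] at h1
    rw [← hconst _ hp]
    exact h1.symm
  have h1 : f p (extChartAt (𝓡 n) p p) = f x (extChartAt (𝓡 n) x x) :=
    hloc.apply_eq_of_preconnectedSpace p x
  have h2 : f x (extChartAt (𝓡 n) x x) = 0 := by
    have h3 : endo g φ x (extChartAt (𝓡 n) x x) - C • ContinuousLinearMap.id ℝ (Coord n) = 0 := by
      ext1 v
      rw [sub_apply, hx, smul_apply]
      exact sub_self _
    simp only [hf, h3, ContinuousLinearMap.zero_comp, map_zero]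
  exact eq_smul_of_traceL_sq_eq_zero (isMetricOn_locMetric g p) (isSymmOn_endo g φ p)
    (center_mem p) C (h1.trans h2) v

omit [T2Space M] [CompactSpace M] in
theorem form_eq_smul {C : ℝ} {x : M} (h : ∀ v, endo g φ x (extChartAt (𝓡 n) x x) v = C • v) :
    φ.form x = C • g.inner x := by
  have h1 : modelForm φ.form x = C • modelForm g.inner x := by
    ext u v
    have h2 := metric_endo g φ (center_mem x) u v
    rw [h, localForm_center, locMetric, localForm_center] at h2
    rw [← h2]
    simp
  exact h1

omit [T2Space M] [CompactSpace M] in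
-- A constant multiple of the metric corresponds to a constant multiple of the identity, which is
-- parallel and divergence-free, so already `S` kills it.
theorem mem_kerSStarS_of_form_eq {C : ℝ} (h : ∀ x, φ.form x = C • g.inner x) :
    φ ∈ kerSStarS g := by
  have hA : ∀ (c : M) (y : Coord n), y ∈ dom c →
      endo g φ c y = C • ContinuousLinearMap.id ℝ (Coord n) := by
    intro c y hy
    ext1 u
    refine ((isMetricOn_locMetric g c).isInner y hy).ext fun v => ?_
    rw [metric_endo g φ hy, localForm_apply, modelForm, h]
    simp
    rfl
  have hS : ∀ x : M, opS g φ x = 0 := by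
    intro x
    have hN : covEndo (Gam g x) (endo g φ x) (extChartAt (𝓡 n) x x) = 0 := by
      have h1 : endo g φ x =ᶠ[𝓝 (extChartAt (𝓡 n) x x)]
          fun _ => C • ContinuousLinearMap.id ℝ (Coord n) := by
        filter_upwards [(isOpen_dom x).mem_nhds (center_mem x)] with z hz using hA x z hz
      ext1 u
      ext1 v
      rw [covEndo_apply, h1.fderiv_eq, h1.self_of_nhds]
      simp
    have hη : divVec (locMetric g x) (endo g φ x) (extChartAt (𝓡 n) x x) = 0 := by
      have h2 : divEndo (locMetric g x) (endo g φ x) (extChartAt (𝓡 n) x x) = 0 := by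
        ext1 v
        rw [divEndo_apply, hN]
        simp
      rw [divVec, h2, map_zero, smul_zero]
    refine modelTensor_injective (MultilinearMap.ext fun v => ?_)
    rw [opS_apply, sinOp, hN, hη, sub_apply, sub_apply, symProd_apply]
    simp
    rfl
  intro x
  have h3 : opS g φ = fun p : M => (0 : Tensor n 3 p) := funext hS
  rw [opSStar_opS, h3, covDeriv_zero, metricTrace_zero, neg_zero]

end Kernel

end Sinyukov

end

theorem corollary3 {n : ℕ} (hn : 2 ≤ n) {M : Type*} [TopologicalSpace M] [T2Space M]
    [CompactSpace M] [ConnectedSpace M] [ChartedSpace (EuclideanSpace ℝ (Fin n)) M]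
    [IsManifold (𝓡 n) ∞ M] (g : Sinyukov.Metric n M) (hsec : Sinyukov.NonposCurved g) :
    (∀ φ ∈ Sinyukov.kerSStarS g, Sinyukov.IsParallel g φ) ∧
    ((∃ x : M, Sinyukov.NegCurvedAt g x) →
      Sinyukov.kerSStarS g = {φ | ∃ C : ℝ, ∀ x : M, φ.form x = C • g.inner x}) := by
  refine ⟨fun φ hφ => Sinyukov.isParallel_of_mem_kerSStarS hn hsec hφ, ?_⟩
  rintro ⟨x, hx⟩
  ext φ
  refine ⟨fun hφ => ?_, fun ⟨C, hC⟩ => Sinyukov.mem_kerSStarS_of_form_eq hC⟩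
  -- The constant is the common eigenvalue of `A` at the point of negative curvature; parallelism
  -- spreads it over `M`.
  obtain ⟨C, hC⟩ := Sinyukov.exists_eq_smul_of_neg (Sinyukov.isMetricOn_locMetric g x)
    (Sinyukov.isSymmOn_endo g φ x) (Sinyukov.center_mem x)
    (fun z hz => Sinyukov.sinOp_eq_zero hφ hz)
    (fun z hz => Sinyukov.divVec_eq_zero hn hsec hφ hz) hx.curv_neg
  exact ⟨C, fun p => Sinyukov.form_eq_smul fun v => Sinyukov.endo_eq_smul
    (fun c y hy => Sinyukov.covEndo_eq_zero hn hsec hφ hy) hC p v⟩
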